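/- Let $\mathbb T=\mathbb R/2\pi\mathbb Z$. For $s\ge 0$ let $H^s_p(\mathbb T)$ be the complex Hilbert space of periodic distributions (for $s\ge0$: functions in $L^2(\mathbb T)$) with $\|f\|_{H^s_p}^2=2\pi\sum_{k\in\mathbb Z}(1+|k|^2)^s|\widehat f(k)|^2<\infty$, where $\widehat f(k)=\frac1{2\pi}\int_0^{2\pi}f(x)e^{-ikx}\,dx$, and write $[f]=\frac1{2\pi}\int_0^{2\pi}f(x)\,dx$, $\psi_k(x)=e^{ikx}/\sqrt{2\pi}$. Fix $\alpha>0$ and a smooth function $g\ge 0$ on $\mathbb T$ with $\int_0^{2\pi}g\,dx=1$ such that $\{g>0\}$ is an open interval of $\mathbb T$. Let $(Gh)(x)=g(x)\big[h(x)-\int_0^{2\pi}g(y)h(y)\,dy\big]$, applied at each time to functions of $(x,t)$, and let $U(t)=e^{(\alpha\mathcal H\partial_x^2+\partial_x^3)t}$ ($\mathcal H$ the Hilbert transform) be the unitary group on $H^s_p(\mathbb T)$ given by $\widehat{U(t)f}(k)=e^{ik^2[\alpha\,\mathrm{sgn}(k)-k]t}\widehat f(k)$. Put $\lambda_k=k^3-\alpha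 k|k|$. Let $s\ge0$ and $T>0$. There is a unique family $(q_j)_{j\in\mathbb Z}$ in the closed linear span of $\{e^{i\lambda_kt}:k\in\mathbb Z\}$ in $L^2([0,T])$ such that $\int_0^Te^{i\lambda_kt}\,\overline{q_j(t)}\,dt$ equals $1$ if $\lambda_j=\lambda_k$ and $0$ otherwise. Moreover, there is a bounded linear operator $$\Phi:H^s_p(\mathbb T)\times H^s_p(\mathbb T)\to L^2([0,T];H^s_p(\mathbb T))$$ with the following properties. 1. For all $u_0,u_1\in H^s_p(\mathbb T)$ the control $h=\Phi(u_0,u_1)$ has the form $$h(x,t)=\sum_{j\in\mathbb Z}h_j\,\overline{q_j(t)}\,\psi_j(x),\qquad h_j\in\mathbb C,\quad h_0=0,\tag{1}$$ with convergence in $L^2([0,T];H^s_p(\mathbb T))$. 2. If $[u_0]=[u_1]$, then $\tau\mapsto U(T-\tau)\,G(\Phi(u_0,u_1))(\cdot,\tau)$ is integrable on $[0,T]$ with values in $H^s_p(\mathbb T)$ and $$u_1=U(T)u_0+\int_0^TU(T-\tau)\,G(\Phi(u_0,u_1))(\cdot,\tau)\,d\tau .\tag{2}$$ 3. If $[u_0]=[u_1]$,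 then $\Phi(u_0,u_1)$ is the only $h\in L^2([0,T];H^s_p(\mathbb T))$ of the form (1) that satisfies (2) with $h$ in place of $\Phi(u_0,u_1)$; so $\Phi$ is unique on the closed subspace $\{[u_0]=[u_1]\}$. 4. There is a constant $\nu>0$, depending only on $s,T,g$ and the coefficient $\alpha$ of the equation, such that for all $u_0,u_1\in H^s_p(\mathbb T)$ $$\|\Phi(u_0,u_1)\|_{L^2([0,T];H^s_p)}\le\nu\,\big(\|u_0\|_{H^s_p}+\|u_1\|_{H^s_p}\big).$$ -/

import Mathlib

open MeasureTheory Filter Topology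
open scoped Real NNReal ENNReal ContDiff ComplexConjugate

namespace Benjamin

noncomputable section

instance factTwoPiPos : Fact (0 < 2 * π) := ⟨Real.two_pi_pos⟩

/-- The torus `ℝ / 2πℤ`. -/
abbrev Torus : Type := AddCircle (2 * π)

/-- The Hilbert space of complex square-integrable functions on the torus (as a set of functions it
does not depend on whether Lebesgue measure `dx` or the normalised measure `dx / 2π` is used). -/
abbrev L2Torus : Type := Lp ℂ 2 (AddCircle.haarAddCircle : Measure Torus)

/-- The bracket `1 + |k|²`. -/
def bracket (k : ℤ) : ℝ := 1 + (k : ℝ) ^ 2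

/-- The square-integrable functions `f` with `∑ₖ (1 + |k|²)^s |f̂(k)|² < ∞`, where
`f̂(k) = (1/2π) ∫₀^{2π} f(x) e^{-ikx} dx`. For `s ≥ 0` every periodic distribution with this property
is such a function. -/
def sobolevSubmodule (s : ℝ≥0) : Submodule ℂ L2Torus where
  carrier := {f | Summable fun k : ℤ => bracket k ^ (s : ℝ) * ‖fourierCoeff f k‖ ^ 2}
  zero_mem' := by
    have : ∀ k : ℤ, fourierCoeff (0 : L2Torus) k = 0 := fun k => by
      rw [← fourierBasis_repr]; simp
    refine summable_zero.congr fun k => ?_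
    rw [show fourierCoeff (0 : L2Torus) k = 0 from this k]; simp
  add_mem' := by
    intro f g hf hg
    refine Summable.of_nonneg_of_le (fun k => ?_) (fun k => ?_) ((hf.add hg).mul_left 2)
    · have : 0 ≤ bracket k := by unfold bracket; positivity
      positivity
    · have h0 : 0 ≤ bracket k ^ (s : ℝ) := by
        have : 0 ≤ bracket k := by unfold bracket; positivity
        positivity
      have h1 : fourierCoeff (f + g : L2Torus) k = fourierCoeff f k + fourierCoeff g k := by
        simp only [← fourierBasis_repr, map_add]; rfl
      rw [h1, ← mul_add, mul_left_comm]
      refine mul_le_mul_of_nonneg_left ?_ h0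
      have := norm_add_le (fourierCoeff f k) (fourierCoeff g k)
      nlinarith [norm_nonneg (fourierCoeff f k + fourierCoeff g k),
        sq_nonneg (‖fourierCoeff f k‖ - ‖fourierCoeff g k‖)]
  smul_mem' := by
    intro c f hf
    have h1 : ∀ k, fourierCoeff (c • f : L2Torus) k = c * fourierCoeff f k := fun k => by
      simp only [← fourierBasis_repr, map_smul]; rfl
    refine (Summable.mul_left (‖c‖ ^ 2) hf).congr fun k => ?_
    rw [h1, norm_mul, mul_pow]; ring

/-- The periodic Sobolev space `H^s_p(𝕋)`, `s ≥ 0`; its norm is introduced below. -/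
def Sobolev (s : ℝ≥0) : Type := sobolevSubmodule s

variable {s : ℝ≥0}

instance : AddCommGroup (Sobolev s) := inferInstanceAs (AddCommGroup (sobolevSubmodule s))
instance : Module ℂ (Sobolev s) := inferInstanceAs (Module ℂ (sobolevSubmodule s))

/-- The underlying square-integrable function of an element of `H^s_p(𝕋)`. -/
def toL2 : Sobolev s →ₗ[ℂ] L2Torus := (sobolevSubmodule s).subtype

instance : CoeFun (Sobolev s) (fun _ => Torus → ℂ) := ⟨fun f => ⇑(toL2 f)⟩

theorem toL2_injective : Function.Injective (toL2 (s := s)) := Subtype.val_injective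

theorem bracket_pos (k : ℤ) : 0 < bracket k := by unfold bracket; positivity

theorem one_le_bracket (k : ℤ) : 1 ≤ bracket k := by
  unfold bracket; nlinarith [sq_nonneg (k : ℝ)]

/-- The weight `√(2π) (1 + |k|²)^{s/2}`. -/
def weight (s : ℝ≥0) (k : ℤ) : ℝ := √(2 * π) * bracket k ^ ((s : ℝ) / 2)

theorem weight_pos (s : ℝ≥0) (k : ℤ) : 0 < weight s k := by
  have := bracket_pos k
  have := Real.two_pi_pos
  unfold weight; positivity

theorem weight_sq (s : ℝ≥0) (k : ℤ) : weight s k ^ 2 = 2 * π * bracket k ^ (s : ℝ) := by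
  unfold weight
  rw [mul_pow, Real.sq_sqrt Real.two_pi_pos.le, ← Real.rpow_natCast, ← Real.rpow_mul
    (bracket_pos k).le]
  norm_num

theorem one_le_weight (s : ℝ≥0) (k : ℤ) : 1 ≤ weight s k := by
  have h1 : 1 ≤ √(2 * π) := by
    rw [Real.one_le_sqrt]; linarith [Real.pi_gt_three]
  have h2 : 1 ≤ bracket k ^ ((s : ℝ) / 2) :=
    Real.one_le_rpow (one_le_bracket k) (by positivity)
  unfold weight; nlinarith

theorem memlp_iff (a : ℤ → ℂ) : Memℓp a 2 ↔ Summable fun k => ‖a k‖ ^ 2 := by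
  rw [memℓp_gen_iff (by norm_num)]
  norm_num

theorem coeff_add (f g : Sobolev s) (k : ℤ) :
    fourierCoeff (f + g) k = fourierCoeff f k + fourierCoeff g k := by
  simp only [← fourierBasis_repr, map_add]; rfl

theorem coeff_smul (c : ℂ) (f : Sobolev s) (k : ℤ) :
    fourierCoeff (c • f) k = c * fourierCoeff f k := by
  simp only [← fourierBasis_repr, map_smul]; rfl

theorem weighted_summable (f : Sobolev s) :
    Summable fun k => ‖(weight s k : ℂ) * fourierCoeff f k‖ ^ 2 := by
  have hf : Summable fun k : ℤ => bracket k ^ (s : ℝ) * ‖fourierCoeff f k‖ ^ 2 := f.2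
  refine (hf.mul_left (2 * π)).congr fun k => ?_
  rw [norm_mul, mul_pow, Complex.norm_real, Real.norm_eq_abs, sq_abs, weight_sq]; ring

/-- The sequence `√(2π) (1 + |k|²)^{s/2} f̂(k)`, an element of `ℓ²(ℤ)`. -/
def weightedCoeff : Sobolev s →ₗ[ℂ] lp (fun _ : ℤ => ℂ) 2 where
  toFun f := ⟨fun k => (weight s k : ℂ) * fourierCoeff f k,
    (memlp_iff _).2 (weighted_summable f)⟩
  map_add' f g := by
    ext k
    simp only [lp.coeFn_add, Pi.add_apply]
    rw [coeff_add, mul_add]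
  map_smul' c f := by
    ext k
    simp only [lp.coeFn_smul, Pi.smul_apply, RingHom.id_apply, smul_eq_mul]
    rw [coeff_smul]; ring

theorem weightedCoeff_apply (f : Sobolev s) (k : ℤ) :
    weightedCoeff f k = (weight s k : ℂ) * fourierCoeff f k := rfl

theorem ext_coeff {f g : Sobolev s} (h : ∀ k, fourierCoeff f k = fourierCoeff g k) : f = g := by
  apply toL2_injective
  apply fourierBasis.repr.injective
  ext k
  rw [fourierBasis_repr, fourierBasis_repr, h]

theorem weightedCoeff_injective : Function.Injective (weightedCoeff (s := s)) := by
  intro f g h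
  refine ext_coeff fun k => ?_
  have h1 : weightedCoeff f k = weightedCoeff g k := by rw [h]
  rw [weightedCoeff_apply, weightedCoeff_apply] at h1
  exact mul_left_cancel₀ (by exact_mod_cast (weight_pos s k).ne') h1

instance : NormedAddCommGroup (Sobolev s) :=
  NormedAddCommGroup.induced _ _ (weightedCoeff (s := s)) weightedCoeff_injective

instance : NormedSpace ℂ (Sobolev s) := NormedSpace.induced ℂ _ _ (weightedCoeff (s := s))

theorem norm_eq (f : Sobolev s) : ‖f‖ = ‖weightedCoeff f‖ := rfl

theorem lp_norm_sq (a : lp (fun _ : ℤ => ℂ) 2) : HasSum (fun k => ‖a k‖ ^ 2) (‖a‖ ^ 2) := by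
  have := lp.hasSum_norm (p := 2) (by norm_num) a
  simpa using this

/-- The norm of `H^s_p(𝕋)`: `‖f‖² = 2π ∑ₖ (1 + |k|²)^s |f̂(k)|²`. -/
theorem norm_sq_eq (f : Sobolev s) :
    ‖f‖ ^ 2 = 2 * π * ∑' k : ℤ, bracket k ^ (s : ℝ) * ‖fourierCoeff f k‖ ^ 2 := by
  rw [norm_eq, ← (lp_norm_sq _).tsum_eq, ← tsum_mul_left]
  refine tsum_congr fun k => ?_
  rw [weightedCoeff_apply, norm_mul, mul_pow, Complex.norm_real, Real.norm_eq_abs, sq_abs,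
    weight_sq]; ring

/-- A function is determined by its (suitably summable) Fourier coefficients. -/
theorem exists_of_coeff (c : ℤ → ℂ) (hc : Summable fun k => ‖(weight s k : ℂ) * c k‖ ^ 2) :
    ∃ f : Sobolev s, ∀ k, fourierCoeff f k = c k := by
  have h1 : Memℓp c 2 := by
    rw [memlp_iff]
    refine Summable.of_nonneg_of_le (fun k => by positivity) (fun k => ?_) hc
    rw [norm_mul, mul_pow, Complex.norm_real, Real.norm_eq_abs, sq_abs]
    have := one_le_weight s k
    have h2 : 1 ≤ weight s k ^ 2 := by nlinarith
    nlinarith [sq_nonneg ‖c k‖]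
  let F : L2Torus := fourierBasis.repr.symm ⟨c, h1⟩
  have hF : ∀ k, fourierCoeff F k = c k := fun k => by
    rw [← fourierBasis_repr]; simp [F]
  refine ⟨⟨F, ?_⟩, hF⟩
  show Summable _
  refine (hc.mul_left (2 * π)⁻¹).congr fun k => ?_
  rw [hF, norm_mul, mul_pow, Complex.norm_real, Real.norm_eq_abs, sq_abs, weight_sq]
  have := Real.two_pi_pos.ne'
  field_simp

theorem weightedCoeff_surjective : Function.Surjective (weightedCoeff (s := s)) := by
  intro a
  have h : ∀ k, (weight s k : ℂ) * ((weight s k : ℂ)⁻¹ * a k) = a k := fun k =>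
    mul_inv_cancel_left₀ (by exact_mod_cast (weight_pos s k).ne') _
  obtain ⟨f, hf⟩ := exists_of_coeff (s := s) (fun k => (weight s k : ℂ)⁻¹ * a k) (by
    simp only [h]; exact (lp_norm_sq a).summable)
  refine ⟨f, ?_⟩
  ext k
  rw [weightedCoeff_apply, hf, h]

instance : CompleteSpace (Sobolev s) := by
  let e : Sobolev s ≃ₗᵢ[ℂ] lp (fun _ : ℤ => ℂ) 2 :=
    { LinearEquiv.ofBijective weightedCoeff
        ⟨weightedCoeff_injective, weightedCoeff_surjective⟩ with
      norm_map' := fun f => (norm_eq f).symm }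
  exact (completeSpace_congr (e := e.toEquiv) e.isometry.isUniformEmbedding).2 inferInstance

theorem norm_of_coeff {f g : Sobolev s} (h : ∀ k, ‖fourierCoeff f k‖ = ‖fourierCoeff g k‖) :
    ‖f‖ = ‖g‖ := by
  have : ‖f‖ ^ 2 = ‖g‖ ^ 2 := by
    rw [norm_sq_eq, norm_sq_eq]; simp only [h]
  exact (sq_eq_sq₀ (norm_nonneg _) (norm_nonneg _)).1 this

/-- The symbol `exp(i k² [α sgn(k) - k] t)`. -/
def symbol (α t : ℝ) (k : ℤ) : ℂ :=
  Complex.exp (Complex.I * (((k : ℝ) ^ 2 * (α * (k.sign : ℝ) - (k : ℝ)) * t : ℝ) : ℂ))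

theorem norm_symbol (α t : ℝ) (k : ℤ) : ‖symbol α t k‖ = 1 := by
  unfold symbol; rw [mul_comm]; exact Complex.norm_exp_ofReal_mul_I _

theorem exists_evolution (α t : ℝ) (f : Sobolev s) :
    ∃ u : Sobolev s, ∀ k, fourierCoeff u k = symbol α t k * fourierCoeff f k :=
  exists_of_coeff _ ((weighted_summable f).congr fun k => by
    simp only [norm_mul, norm_symbol, one_mul])

/-- The unitary group `U(t) = exp((α H ∂ₓ² + ∂ₓ³) t)` on `H^s_p(𝕋)`, the Fourier multiplier with
symbol `exp(i k² [α sgn(k) - k] t)`. -/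
def evolution (s : ℝ≥0) (α t : ℝ) : Sobolev s →ₗᵢ[ℂ] Sobolev s where
  toFun f := (exists_evolution α t f).choose
  map_add' f g := ext_coeff fun k => by
    rw [coeff_add]
    simp only [(exists_evolution α t _).choose_spec]
    rw [coeff_add, mul_add]
  map_smul' c f := ext_coeff fun k => by
    rw [RingHom.id_apply, coeff_smul]
    simp only [(exists_evolution α t _).choose_spec]
    rw [coeff_smul]; ring
  norm_map' f := norm_of_coeff fun k => by
    show ‖fourierCoeff (exists_evolution α t f).choose k‖ = _
    rw [(exists_evolution α t f).choose_spec, norm_mul, norm_symbol, one_mul]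

theorem coeff_evolution (α t : ℝ) (f : Sobolev s) (k : ℤ) :
    fourierCoeff (evolution s α t f) k = symbol α t k * fourierCoeff f k :=
  (exists_evolution α t f).choose_spec k

theorem exists_expMode (s : ℝ≥0) (k : ℤ) :
    ∃ f : Sobolev s, toL2 f = fourierLp 2 k := by
  classical
  have hc : ∀ j, fourierCoeff (fourierLp 2 k : L2Torus) j = if j = k then 1 else 0 := fun j => by
    rw [← fourierBasis_repr, ← coe_fourierBasis, HilbertBasis.repr_self, lp.single_apply,
      Pi.single_apply]
  obtain ⟨f, hf⟩ := exists_of_coeff (s := s)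
    (fun j => fourierCoeff (fourierLp 2 k : L2Torus) j) (by
      refine summable_of_ne_finset_zero (s := {k}) fun j hj => ?_
      rw [hc, if_neg (by simpa using hj)]; simp)
  refine ⟨f, fourierBasis.repr.injective ?_⟩
  ext j
  rw [fourierBasis_repr, fourierBasis_repr, hf]

/-- The function `e^{ikx}` as an element of `H^s_p(𝕋)`. -/
def expMode (s : ℝ≥0) (k : ℤ) : Sobolev s := (exists_expMode s k).choose

theorem toL2_expMode (s : ℝ≥0) (k : ℤ) : toL2 (expMode s k) = fourierLp 2 k :=
  (exists_expMode s k).choose_spec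

/-- The normalised function `ψₖ(x) = e^{ikx} / √(2π)`. -/
def psi (s : ℝ≥0) (k : ℤ) : Sobolev s := ((√(2 * π) : ℝ) : ℂ)⁻¹ • expMode s k

/-- The mean value `[f] = (1/2π) ∫₀^{2π} f(x) dx`. -/
def mean (f : Sobolev s) : ℂ := (1 / (2 * π) : ℂ) * ∫ x : Torus, f x

/-- Smooth real functions on the torus. -/
def SmoothTorus (g : Torus → ℝ) : Prop := ContDiff ℝ ∞ fun x : ℝ => g (x : Torus)

theorem SmoothTorus.continuous {g : Torus → ℝ} (hg : SmoothTorus g) : Continuous g :=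
  isQuotientMap_quotient_mk'.continuous_iff.2 (ContDiff.continuous hg)

theorem intervalCoeff_deriv {φ : ℝ → ℂ} (hφ : ContDiff ℝ ∞ φ)
    (hper : ∀ x, φ (x + 2 * π) = φ x) {n : ℤ} (hn : n ≠ 0) :
    fourierCoeffOn Real.two_pi_pos φ n
      = (Complex.I * n)⁻¹ * fourierCoeffOn Real.two_pi_pos (deriv φ) n := by
  have hd : ContDiff ℝ ∞ (deriv φ) := ((contDiff_infty_iff_deriv).1 hφ).2
  rw [fourierCoeffOn_of_hasDerivAt Real.two_pi_pos hn
    (fun x _ => (hφ.differentiable (by simp) x).hasDerivAt)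
    (hd.continuous.intervalIntegrable _ _)]
  have h0 : φ (2 * π) = φ 0 := by simpa using hper 0
  have hpi : (π : ℂ) ≠ 0 := by exact_mod_cast Real.pi_ne_zero
  have hn' : (n : ℂ) ≠ 0 := by exact_mod_cast hn
  rw [h0]
  push_cast
  field_simp
  ring

theorem intervalCoeff_iter (N : ℕ) : ∀ {φ : ℝ → ℂ}, ContDiff ℝ ∞ φ →
    (∀ x, φ (x + 2 * π) = φ x) →
    ∃ C, ∀ n : ℤ, n ≠ 0 → ‖fourierCoeffOn Real.two_pi_pos φ n‖ * |(n : ℝ)| ^ N ≤ C := by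
  induction N with
  | zero =>
    intro φ hφ hper
    obtain ⟨C, hC⟩ := (isCompact_Icc (a := (0 : ℝ)) (b := 2 * π)).exists_bound_of_continuousOn
      hφ.continuous.continuousOn
    refine ⟨C, fun n _ => ?_⟩
    rw [pow_zero, mul_one, fourierCoeffOn_eq_integral]
    have h1 : ‖∫ x in (0 : ℝ)..2 * π, fourier (-n) (x : AddCircle (2 * π - 0)) • φ x‖
        ≤ C * |2 * π - 0| := by
      refine intervalIntegral.norm_integral_le_of_norm_le_const fun x hx => ?_
      rw [Set.uIoc_of_le Real.two_pi_pos.le] at hx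
      rw [norm_smul, fourier_apply, Circle.norm_coe, one_mul]
      exact hC x ⟨hx.1.le, hx.2⟩
    have h2 := Real.two_pi_pos
    rw [norm_smul, Real.norm_eq_abs]
    rw [sub_zero, abs_of_pos h2] at h1
    rw [sub_zero, abs_of_pos (by positivity)]
    calc _ ≤ 1 / (2 * π) * (C * (2 * π)) := by
          refine mul_le_mul_of_nonneg_left ?_ (by positivity)
          simpa using h1
      _ = C := by field_simp
  | succ N ih =>
    intro φ hφ hper
    obtain ⟨C, hC⟩ := ih ((contDiff_infty_iff_deriv).1 hφ).2 (fun x => by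
      rw [← deriv_comp_add_const]; simp only [hper])
    refine ⟨C, fun n hn => ?_⟩
    rw [intervalCoeff_deriv hφ hper hn, norm_mul, norm_inv, norm_mul, Complex.norm_I, one_mul,
      Complex.norm_intCast]
    have : 0 < |(n : ℝ)| := by positivity
    calc _ = ‖fourierCoeffOn Real.two_pi_pos (deriv φ) n‖ * |(n : ℝ)| ^ N := by
          rw [pow_succ]; field_simp
      _ ≤ C := hC n hn

theorem coeff_decay {g : Torus → ℝ} (hg : SmoothTorus g) (N : ℕ) :
    ∃ C, ∀ n : ℤ, n ≠ 0 → ‖fourierCoeff (fun x => (g x : ℂ)) n‖ * |(n : ℝ)| ^ N ≤ C := by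
  obtain ⟨C, hC⟩ := intervalCoeff_iter N (φ := fun x : ℝ => (g (x : Torus) : ℂ))
    (Complex.ofRealCLM.contDiff.comp hg) (fun x => by
      simp only [AddCircle.coe_add_period])
  refine ⟨C, fun n hn => ?_⟩
  have h := hC n hn
  rw [fourierCoeffOn_eq_integral] at h
  rw [fourierCoeff_eq_intervalIntegral _ n 0]
  simpa using h

theorem summable_weight_coeff (s : ℝ≥0) {g : Torus → ℝ} (hg : SmoothTorus g) :
    Summable fun m : ℤ => ‖fourierCoeff (fun x => (g x : ℂ)) m‖ * bracket m ^ ((s : ℝ) / 2) := by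
  obtain ⟨M, hM⟩ := exists_nat_ge ((s : ℝ) / 2)
  obtain ⟨C, hC⟩ := coeff_decay hg (2 * M + 2)
  have hs : Summable fun m : ℤ => C * 2 ^ M * (1 / (m : ℝ) ^ 2) :=
    (Real.summable_one_div_int_pow.2 (by norm_num)).mul_left _
  refine Summable.of_norm_bounded_eventually hs ?_
  have hfin : {m : ℤ | ¬ (‖‖fourierCoeff (fun x => (g x : ℂ)) m‖ * bracket m ^ ((s : ℝ) / 2)‖
      ≤ C * 2 ^ M * (1 / (m : ℝ) ^ 2))} ⊆ {0} := by
    intro m hm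
    by_contra h0
    apply hm
    have hm0 : m ≠ 0 := h0
    have hm1 : (1 : ℝ) ≤ (m : ℝ) ^ 2 := by
      have : 0 < m ^ 2 := by positivity
      exact_mod_cast this
    have hb : bracket m ^ ((s : ℝ) / 2) ≤ 2 ^ M * ((m : ℝ) ^ 2) ^ M := by
      calc bracket m ^ ((s : ℝ) / 2) ≤ bracket m ^ (M : ℝ) :=
            Real.rpow_le_rpow_of_exponent_le (one_le_bracket m) hM
        _ = bracket m ^ M := Real.rpow_natCast _ _
        _ ≤ (2 * (m : ℝ) ^ 2) ^ M := by
            refine pow_le_pow_left₀ (bracket_pos m).le ?_ M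
            unfold bracket; linarith
        _ = _ := mul_pow _ _ _
    have hpos := bracket_pos m
    rw [Real.norm_of_nonneg (by positivity)]
    have h1 := hC m hm0
    have h2 : |(m : ℝ)| ^ (2 * M + 2) = ((m : ℝ) ^ 2) ^ M * (m : ℝ) ^ 2 := by
      rw [pow_add, pow_mul, sq_abs]
    rw [h2] at h1
    rw [mul_one_div, le_div_iff₀ (by positivity)]
    calc _ ≤ ‖fourierCoeff (fun x => (g x : ℂ)) m‖ * (2 ^ M * ((m : ℝ) ^ 2) ^ M) * (m : ℝ) ^ 2 := by
          gcongr
      _ = (‖fourierCoeff (fun x => (g x : ℂ)) m‖ * (((m : ℝ) ^ 2) ^ M * (m : ℝ) ^ 2)) * 2 ^ M := by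
          ring
      _ ≤ C * 2 ^ M := by gcongr
  exact (Set.finite_singleton (0 : ℤ)).subset hfin

theorem bracket_shift (k m : ℤ) : bracket k ≤ 2 * bracket m * bracket (k - m) := by
  unfold bracket; push_cast
  nlinarith [sq_nonneg ((k : ℝ) - 2 * m), sq_nonneg ((m : ℝ) * ((k : ℝ) - m))]

/-- The constant `(2 (1 + |m|²))^{s/2}`. -/
def shiftConst (s : ℝ≥0) (m : ℤ) : ℝ := (2 * bracket m) ^ ((s : ℝ) / 2)

theorem shiftConst_nonneg (s : ℝ≥0) (m : ℤ) : 0 ≤ shiftConst s m := by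
  have := bracket_pos m
  unfold shiftConst; positivity

theorem weight_shift (s : ℝ≥0) (k m : ℤ) :
    weight s k ≤ shiftConst s m * weight s (k - m) := by
  have h1 := bracket_pos m
  have h2 := bracket_pos (k - m)
  have : bracket k ^ ((s : ℝ) / 2) ≤ (2 * bracket m) ^ ((s : ℝ) / 2)
      * bracket (k - m) ^ ((s : ℝ) / 2) := by
    rw [← Real.mul_rpow (by positivity) h2.le]
    exact Real.rpow_le_rpow (bracket_pos k).le (bracket_shift k m) (by positivity)
  unfold weight shiftConst
  calc _ ≤ √(2 * π) * ((2 * bracket m) ^ ((s : ℝ) / 2) * bracket (k - m) ^ ((s : ℝ) / 2)) := by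
        gcongr
    _ = _ := by ring

theorem norm_sq_hasSum (f : Sobolev s) :
    HasSum (fun k => ‖(weight s k : ℂ) * fourierCoeff f k‖ ^ 2) (‖f‖ ^ 2) :=
  lp_norm_sq (weightedCoeff f)

theorem exists_shift (m : ℤ) (f : Sobolev s) : ∃ u : Sobolev s,
    (∀ k, fourierCoeff u k = fourierCoeff f (k - m)) ∧ ‖u‖ ≤ shiftConst s m * ‖f‖ := by
  have hle : ∀ k, ‖(weight s k : ℂ) * fourierCoeff f (k - m)‖ ^ 2
      ≤ shiftConst s m ^ 2 * ‖(weight s (k - m) : ℂ) * fourierCoeff f (k - m)‖ ^ 2 := fun k => by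
    rw [← mul_pow, norm_mul, norm_mul, Complex.norm_real, Complex.norm_real, Real.norm_eq_abs,
      Real.norm_eq_abs, abs_of_pos (weight_pos s k), abs_of_pos (weight_pos s _), ← mul_assoc]
    have := weight_pos s k
    gcongr
    exact weight_shift s k m
  have hS : HasSum (fun k => shiftConst s m ^ 2
      * ‖(weight s (k - m) : ℂ) * fourierCoeff f (k - m)‖ ^ 2) (shiftConst s m ^ 2 * ‖f‖ ^ 2) :=
    ((Equiv.subRight m).hasSum_iff.2 (norm_sq_hasSum f)).mul_left _
  obtain ⟨u, hu⟩ := exists_of_coeff (s := s) (fun k => fourierCoeff f (k - m))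
    (Summable.of_nonneg_of_le (fun k => by positivity) hle hS.summable)
  refine ⟨u, hu, ?_⟩
  have h2 := hasSum_le (fun k => by rw [hu]; exact hle k) (norm_sq_hasSum u) hS
  rw [← mul_pow] at h2
  exact (sq_le_sq₀ (norm_nonneg _) (mul_nonneg (shiftConst_nonneg s m) (norm_nonneg _))).1 h2

/-- The `k`-th Fourier coefficient as a bounded linear functional. -/
def coeffCLM (s : ℝ≥0) (k : ℤ) : Sobolev s →L[ℂ] ℂ :=
  LinearMap.mkContinuous
    { toFun := fun f => fourierCoeff f k
      map_add' := fun f g => coeff_add f g k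
      map_smul' := fun c f => coeff_smul c f k } 1 (fun f => by
    have h := (norm_sq_hasSum f).summable.le_tsum k (fun _ _ => by positivity)
    rw [(norm_sq_hasSum f).tsum_eq] at h
    have h1 := (sq_le_sq₀ (norm_nonneg _) (norm_nonneg _)).1 h
    rw [norm_mul, Complex.norm_real, Real.norm_eq_abs, abs_of_pos (weight_pos s k)] at h1
    rw [one_mul]
    refine le_trans ?_ h1
    have := one_le_weight s k
    show ‖fourierCoeff f k‖ ≤ _
    nlinarith [norm_nonneg (fourierCoeff f k)])

theorem coeffCLM_apply (k : ℤ) (f : Sobolev s) : coeffCLM s k f = fourierCoeff f k := rfl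

theorem summable_shiftConst (s : ℝ≥0) {g : Torus → ℝ} (hg : SmoothTorus g) :
    Summable fun m : ℤ => ‖fourierCoeff (fun x => (g x : ℂ)) m‖ * shiftConst s m := by
  refine ((summable_weight_coeff s hg).mul_left (2 ^ ((s : ℝ) / 2))).congr fun m => ?_
  rw [shiftConst, Real.mul_rpow (by norm_num) (bracket_pos m).le]; ring

theorem hasSum_coeff_mul (G : C(Torus, ℂ)) (hsum : Summable fun m : ℤ => ‖fourierCoeff G m‖)
    (F : Torus → ℂ) (hF : Integrable F (AddCircle.haarAddCircle : Measure Torus)) (k : ℤ) :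
    HasSum (fun m => fourierCoeff G m * fourierCoeff F (k - m))
      (fourierCoeff (fun x => G x * F x) k) := by
  have hint (m : ℤ) : Integrable
      (fun x : Torus => fourierCoeff G m • (fourier (-(k - m)) x • F x))
      AddCircle.haarAddCircle :=
    Integrable.smul (fourierCoeff G m) (hF.fourier_smul (-(k - m)))
  have hnorm (m : ℤ) : ∫ x : Torus, ‖fourierCoeff G m • (fourier (-(k - m)) x • F x)‖
      ∂AddCircle.haarAddCircle
      = ‖fourierCoeff G m‖ * ∫ x : Torus, ‖F x‖ ∂AddCircle.haarAddCircle := by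
    rw [← integral_const_mul]
    refine integral_congr_ae (Eventually.of_forall fun x => ?_)
    simp only [norm_smul, fourier_apply, Circle.norm_coe, one_mul]
  have hsn : Summable fun m : ℤ => ∫ x : Torus, ‖fourierCoeff G m • (fourier (-(k - m)) x • F x)‖
      ∂AddCircle.haarAddCircle := by
    simp only [hnorm]
    exact hsum.mul_right _
  have key := hasSum_integral_of_summable_integral_norm hint hsn
  have e1 (m : ℤ) : ∫ x : Torus, fourierCoeff G m • (fourier (-(k - m)) x • F x)
      ∂AddCircle.haarAddCircle = fourierCoeff G m * fourierCoeff F (k - m) := by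
    rw [integral_smul, smul_eq_mul, fourierCoeff, fourierCoeff]
  have e2 : ∫ x : Torus, ∑' m, fourierCoeff G m • (fourier (-(k - m)) x • F x)
      ∂AddCircle.haarAddCircle = fourierCoeff (fun x => G x * F x) k := by
    rw [fourierCoeff]
    refine integral_congr_ae (Eventually.of_forall fun x => ?_)
    have hpt := has_pointwise_sum_fourier_series_of_summable (f := G) hsum.of_norm x
    have h := (hpt.mul_right (fourier (-k) x * F x)).tsum_eq
    have h3 (m : ℤ) : fourierCoeff G m • (fourier (-(k - m)) x • F x)
        = fourierCoeff G m • fourier m x * (fourier (-k) x * F x) := by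
      rw [show -(k - m) = m + -k by ring, fourier_add]
      simp only [smul_eq_mul]; ring
    simp only [h3]
    rw [h, smul_eq_mul]; ring
  rw [e2] at key
  simpa only [e1] using key

theorem coeff_mul {g : Torus → ℝ} (hg : SmoothTorus g) (f : Sobolev s) (k : ℤ) :
    HasSum (fun m => fourierCoeff (fun x => (g x : ℂ)) m * fourierCoeff f (k - m))
      (fourierCoeff (fun x => (g x : ℂ) * f x) k) := by
  refine hasSum_coeff_mul ⟨fun x => (g x : ℂ), Complex.continuous_ofReal.comp hg.continuous⟩ ?_ f
    ((Lp.memLp (toL2 f)).integrable (by norm_num)) k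
  refine Summable.of_nonneg_of_le (fun _ => norm_nonneg _) (fun m => ?_)
    (summable_weight_coeff s hg)
  exact le_mul_of_one_le_right (norm_nonneg _)
    (Real.one_le_rpow (one_le_bracket m) (by positivity))

theorem memLp_mul {g : Torus → ℝ} (hg : SmoothTorus g) (f : L2Torus) :
    MemLp (fun x => (g x : ℂ) * f x) 2 (AddCircle.haarAddCircle : Measure Torus) := by
  have hc : Continuous fun x => (g x : ℂ) := Complex.continuous_ofReal.comp hg.continuous
  obtain ⟨C, hC⟩ := (isCompact_univ (X := Torus)).exists_bound_of_continuousOn hc.continuousOn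
  refine MemLp.of_le_mul (c := C) (Lp.memLp f)
    (hc.aestronglyMeasurable.mul (Lp.aestronglyMeasurable f)) (Eventually.of_forall fun x => ?_)
  rw [norm_mul]
  exact mul_le_mul_of_nonneg_right (hC x trivial) (norm_nonneg _)

/-- Multiplication by a smooth function maps `H^s_p(𝕋)` boundedly into itself. -/
theorem exists_mul (s : ℝ≥0) {g : Torus → ℝ} (hg : SmoothTorus g) :
    ∃ C : ℝ, ∀ f : Sobolev s, ∃ u : Sobolev s,
      toL2 u = (memLp_mul hg (toL2 f)).toLp _ ∧ ‖u‖ ≤ C * ‖f‖ := by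
  refine ⟨∑' m : ℤ, ‖fourierCoeff (fun x => (g x : ℂ)) m‖ * shiftConst s m, fun f => ?_⟩
  choose S hS hSn using fun m => exists_shift m f
  have hsm := (summable_shiftConst s hg).mul_right ‖f‖
  have hb (m : ℤ) : ‖fourierCoeff (fun x => (g x : ℂ)) m • S m‖
      ≤ ‖fourierCoeff (fun x => (g x : ℂ)) m‖ * shiftConst s m * ‖f‖ := by
    rw [norm_smul, mul_assoc]
    exact mul_le_mul_of_nonneg_left (hSn m) (norm_nonneg _)
  have hu := (Summable.of_norm_bounded hsm hb).hasSum
  refine ⟨∑' m, fourierCoeff (fun x => (g x : ℂ)) m • S m, ?_, ?_⟩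
  · apply fourierBasis.repr.injective
    ext k
    rw [fourierBasis_repr, fourierBasis_repr, ← coeffCLM_apply,
      fourierCoeff_congr_ae (MemLp.coeFn_toLp _)]
    refine HasSum.unique ((coeffCLM s k).hasSum hu) ?_
    refine (coeff_mul hg f k).congr_fun fun m => ?_
    rw [map_smul, coeffCLM_apply, hS, smul_eq_mul]
  · rw [← tsum_mul_right]
    exact tsum_of_norm_bounded hsm.hasSum hb

theorem exists_mul_clm (s : ℝ≥0) {g : Torus → ℝ} (hg : SmoothTorus g) :
    ∃ M : Sobolev s →L[ℂ] Sobolev s, ∀ f, toL2 (M f) = (memLp_mul hg (toL2 f)).toLp _ := by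
  obtain ⟨C, hC⟩ := exists_mul s hg
  choose M hM hMC using hC
  refine ⟨LinearMap.mkContinuous
    { toFun := M
      map_add' := fun f h => toL2_injective ?_
      map_smul' := fun c f => toL2_injective ?_ } C hMC, hM⟩
  · rw [map_add, hM, hM, hM, ← MemLp.toLp_add]
    refine (MemLp.toLp_eq_toLp_iff _ _).2 ?_
    rw [map_add]
    filter_upwards [Lp.coeFn_add (toL2 f) (toL2 h)] with x hx
    rw [hx, Pi.add_apply, Pi.add_apply, mul_add]
  · rw [RingHom.id_apply, map_smul, hM, hM, ← MemLp.toLp_const_smul]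
    refine (MemLp.toLp_eq_toLp_iff _ _).2 ?_
    rw [map_smul]
    filter_upwards [Lp.coeFn_smul c (toL2 f)] with x hx
    rw [hx, Pi.smul_apply, Pi.smul_apply, smul_eq_mul, smul_eq_mul]; ring

/-- Multiplication by the smooth function `g`, as a bounded operator on `H^s_p(𝕋)`. -/
def mulOp (s : ℝ≥0) {g : Torus → ℝ} (hg : SmoothTorus g) : Sobolev s →L[ℂ] Sobolev s :=
  (exists_mul_clm s hg).choose

theorem mulOp_ae {g : Torus → ℝ} (hg : SmoothTorus g) (f : Sobolev s) :
    mulOp s hg f =ᵐ[AddCircle.haarAddCircle] fun x => (g x : ℂ) * f x := by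
  show toL2 (mulOp s hg f) =ᵐ[_] _
  rw [mulOp, (exists_mul_clm s hg).choose_spec f]
  exact MemLp.coeFn_toLp _

/-- The constant function `1`. -/
def one (s : ℝ≥0) : Sobolev s := expMode s 0

theorem one_ae (s : ℝ≥0) : one s =ᵐ[AddCircle.haarAddCircle] fun _ => (1 : ℂ) := by
  show toL2 (expMode s 0) =ᵐ[_] _
  rw [toL2_expMode]
  filter_upwards [coeFn_fourierLp (T := 2 * π) 2 0] with x hx
  rw [hx, fourier_zero]

/-- The functional `h ↦ ∫₀^{2π} g(y) h(y) dy`. -/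
def pairing (s : ℝ≥0) {g : Torus → ℝ} (hg : SmoothTorus g) : Sobolev s →L[ℂ] ℂ :=
  (2 * π : ℂ) • (coeffCLM s 0).comp (mulOp s hg)

theorem pairing_apply {g : Torus → ℝ} (hg : SmoothTorus g) (h : Sobolev s) :
    pairing s hg h = ∫ y : Torus, (g y : ℂ) * h y := by
  have h1 : coeffCLM s 0 (mulOp s hg h) = ((2 * π)⁻¹ : ℝ) • ∫ y : Torus, (g y : ℂ) * h y := by
    rw [coeffCLM_apply, fourierCoeff_congr_ae (mulOp_ae hg h), fourierCoeff,
      AddCircle.integral_haarAddCircle]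
    simp
  have hpi : (π : ℂ) ≠ 0 := by exact_mod_cast Real.pi_ne_zero
  show (2 * π : ℂ) * coeffCLM s 0 (mulOp s hg h) = _
  rw [h1, Complex.real_smul]
  push_cast
  field_simp

/-- The control operator `(G h)(x) = g(x) [h(x) - ∫₀^{2π} g(y) h(y) dy]` on `H^s_p(𝕋)`. -/
def controlOp (s : ℝ≥0) {g : Torus → ℝ} (hg : SmoothTorus g) : Sobolev s →L[ℂ] Sobolev s :=
  (mulOp s hg).comp
    (ContinuousLinearMap.id ℂ (Sobolev s) - (pairing s hg).smulRight (one s))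

theorem controlOp_ae {g : Torus → ℝ} (hg : SmoothTorus g) (h : Sobolev s) :
    controlOp s hg h =ᵐ[AddCircle.haarAddCircle]
      fun x => (g x : ℂ) * (h x - ∫ y : Torus, (g y : ℂ) * h y) := by
  show mulOp s hg (h - pairing s hg h • one s) =ᵐ[_] _
  filter_upwards [mulOp_ae hg (h - pairing s hg h • one s),
    Lp.coeFn_sub (toL2 h) (pairing s hg h • toL2 (one s)),
    Lp.coeFn_smul (pairing s hg h) (toL2 (one s)), one_ae s] with x h1 h2 h3 h4
  rw [h1, map_sub, map_smul, h2, Pi.sub_apply, h3, Pi.smul_apply, h4, pairing_apply, smul_eq_mul,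
    mul_one]

/-- The standing hypotheses on the control profile `g`: it is smooth, nonnegative, of integral one,
and `{g > 0}` is an open arc of the torus. -/
structure IsControlProfile (g : Torus → ℝ) : Prop where
  smooth : SmoothTorus g
  nonneg : ∀ x, 0 ≤ g x
  integral_eq_one : ∫ x : Torus, g x = 1
  arc : ∃ a b : ℝ, a < b ∧ {x : Torus | 0 < g x} = (fun x : ℝ => (x : Torus)) '' Set.Ioo a b

/-- `L²([0,T]; ℂ)`. -/
abbrev L2Time (T : ℝ) : Type := Lp ℂ 2 (volume.restrict (Set.Icc 0 T))

/-- `L²([0,T]; H^s_p(𝕋))`. -/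
abbrev L2TimeSobolev (s : ℝ≥0) (T : ℝ) : Type := Lp (Sobolev s) 2 (volume.restrict (Set.Icc 0 T))

/-- The eigenvalues `λₖ = k³ - α k |k|`. -/
def eigenvalue (α : ℝ) (k : ℤ) : ℝ := (k : ℝ) ^ 3 - α * k * |(k : ℝ)|

theorem memLp_exp (α T : ℝ) (k : ℤ) :
    MemLp (fun t : ℝ => Complex.exp (Complex.I * eigenvalue α k * t)) 2
      (volume.restrict (Set.Icc 0 T)) := by
  refine MemLp.of_bound (by fun_prop) 1 (Eventually.of_forall fun t => ?_)
  rw [show Complex.I * eigenvalue α k * t = ((eigenvalue α k * t : ℝ) : ℂ) * Complex.I by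
    push_cast; ring, Complex.norm_exp_ofReal_mul_I]

/-- The function `t ↦ e^{iλₖt}` in `L²([0,T])`. -/
def expTime (α T : ℝ) (k : ℤ) : L2Time T := (memLp_exp α T k).toLp _

/-- `q` is the family dual to the exponentials `e^{iλₖt}` inside their closed span in `L²([0,T])`:
`∫₀ᵀ e^{iλₖt} conj(qⱼ(t)) dt` is `1` if `λⱼ = λₖ` and `0` otherwise (so `qⱼ` depends only on the
value of `λⱼ`, and is biorthogonal to the family of distinct exponentials). -/
def IsDualFamily (α T : ℝ) (q : ℤ → L2Time T) : Prop :=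
  (∀ j, q j ∈ (Submodule.span ℂ (Set.range (expTime α T))).topologicalClosure) ∧
  ∀ j k, (eigenvalue α j = eigenvalue α k →
      ∫ t in (0 : ℝ)..T, Complex.exp (Complex.I * eigenvalue α k * t) * conj (q j t) = 1) ∧
    (eigenvalue α j ≠ eigenvalue α k →
      ∫ t in (0 : ℝ)..T, Complex.exp (Complex.I * eigenvalue α k * t) * conj (q j t) = 0)

/-- The element `conj(q(t)) ψⱼ(x)` of `L²([0,T]; H^s_p(𝕋))`. -/
def tensorPsi (s : ℝ≥0) {T : ℝ} (q : L2Time T) (j : ℤ) : L2TimeSobolev s T :=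
  (ContinuousLinearMap.toSpanSingleton ℂ (psi s j)).compLp (star q)

theorem tensorPsi_ae {T : ℝ} (q : L2Time T) (j : ℤ) :
    tensorPsi s q j =ᵐ[volume.restrict (Set.Icc 0 T)] fun t => conj (q t) • psi s j := by
  filter_upwards [ContinuousLinearMap.coeFn_compLp
    (ContinuousLinearMap.toSpanSingleton ℂ (psi s j)) (star q), Lp.coeFn_star q] with t h1 h2
  rw [tensorPsi, h1, h2]
  rfl

/-- `h` has the form `∑ⱼ hⱼ conj(qⱼ(t)) ψⱼ(x)` with `h₀ = 0`, the series converging in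
`L²([0,T]; H^s_p(𝕋))`. -/
def HasMomentForm {T : ℝ} (q : ℤ → L2Time T) (h : L2TimeSobolev s T) : Prop :=
  ∃ c : ℤ → ℂ, c 0 = 0 ∧ HasSum (fun j => c j • tensorPsi s (q j) j) h

/-- The control `h` leads the solution of `∂ₜu - α H ∂ₓ²u - ∂ₓ³u = G h`, `u(0) = u₀`, to
`u(T) = u₁`: `u₁ = U(T) u₀ + ∫₀ᵀ U(T - τ) (G h)(τ) dτ`, the integrand being Bochner integrable in
`H^s_p(𝕋)`. -/
def Steers {g : Torus → ℝ} (hg : SmoothTorus g) (α T : ℝ) (u₀ u₁ : Sobolev s)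
    (h : L2TimeSobolev s T) : Prop :=
  IntervalIntegrable (fun τ => evolution s α (T - τ) (controlOp s hg (h τ))) volume 0 T ∧
  u₁ = evolution s α T u₀ + ∫ τ in (0 : ℝ)..T, evolution s α (T - τ) (controlOp s hg (h τ))

end

end Benjamin

open Benjamin

/-! Comparing k-th Fourier coefficients and undoing `U(T)`, steering from `u₀` to `u₁` means that
for every k the integral of `e^{iλₖτ}` against the k-th coefficient of `(G h)(τ)` equals the k-th
coefficient of `U(-T)u₁ - u₀` (`steers_iff`). For `h = ∑ hⱼ conj(qⱼ) ψⱼ` duality of `qⱼ` turns this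
into a linear system for `(hⱼ)` whose matrix entry at (k, j) vanishes unless `λⱼ = λₖ`, and is then,
up to the factor `1/√(2π)`, the Fourier matrix entry of `G`.

The dual family exists and is bounded because the exponentials with the distinct frequencies `λₖ`
form a Riesz sequence on `[0,T]` for every `T > 0` (`riesz_eigenvalue`). Gaps between frequencies
grow, so a far enough tail has a diagonally dominant Gram matrix (`riesz_of_schur`). The finitely
many remaining frequencies are added one at a time: subtracting an average over a short window kills
one frequency and barely damages the others, at the price of an arbitrarily small amount of time
(`riesz_insert`).

The system is solvable because `λₖ` is simple for large |k|, so outside a finite index set the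
matrix is diagonal, with entries bounded below by decay of `ĝ` (`le_norm_controlMatrix_diag`). On
the finite set it splits into principal blocks of the matrix of `G`. A kernel vector of such a
block, extended by a suitable entry at index 0, is a kernel vector of a Toeplitz matrix of `g`. That
is a trigonometric polynomial `p` with `∫ g|p|² = 0`, hence zero on an arc, hence zero
(`toeplitz_definite`, `controlMatrix_injective`).

Index 0 is special: `G h` always has mean zero, so the equation for k = 0 says exactly `[u₀] =
[u₁]`. `G` also kills constants, so `h₀` is undetermined and is normalised to 0. Boundedness of the
solution map needs only a uniform bound on `‖qⱼ‖`, since the modes `ψⱼ` are already orthogonal in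
`H^s` (`exists_synthesis`). -/

namespace Benjamin

noncomputable section

variable {s : ℝ≥0}

/-! ### Riesz sequences of exponentials: the Gram matrix -/

/-- The exponential sum `∑_{λ ∈ S} a(λ) e^{iλt}`. -/
def expSum (S : Finset ℝ) (a : ℝ → ℂ) (t : ℝ) : ℂ :=
  ∑ l ∈ S, a l * Complex.exp (Complex.I * l * t)

/-- The exponentials with frequencies in `Λ` form a Riesz sequence in `L²([0,T])`. -/
def RieszOn (Λ : Set ℝ) (T : ℝ) : Prop :=
  ∃ c C : ℝ, 0 < c ∧ 0 < C ∧ ∀ S : Finset ℝ, ↑S ⊆ Λ → ∀ a : ℝ → ℂ,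
    c * ∑ l ∈ S, ‖a l‖ ^ 2 ≤ ∫ t in (0 : ℝ)..T, ‖expSum S a t‖ ^ 2 ∧
    ∫ t in (0 : ℝ)..T, ‖expSum S a t‖ ^ 2 ≤ C * ∑ l ∈ S, ‖a l‖ ^ 2

theorem RieszOn.mono {Λ Λ' : Set ℝ} {T : ℝ} (h : RieszOn Λ T) (hs : Λ' ⊆ Λ) : RieszOn Λ' T := by
  obtain ⟨c, C, hc, hC, H⟩ := h
  exact ⟨c, C, hc, hC, fun S hS a => H S (hS.trans hs) a⟩

@[fun_prop]
theorem continuous_expSum (S : Finset ℝ) (a : ℝ → ℂ) : Continuous (expSum S a) := by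
  unfold expSum; fun_prop

theorem norm_exp_I_mul (x t : ℝ) : ‖Complex.exp (Complex.I * x * t)‖ = 1 := by
  rw [show Complex.I * x * t = ((x * t : ℝ) : ℂ) * Complex.I by push_cast; ring,
    Complex.norm_exp_ofReal_mul_I]

theorem norm_integral_exp_le {x : ℝ} (hx : x ≠ 0) (T : ℝ) :
    ‖∫ t in (0 : ℝ)..T, Complex.exp (Complex.I * x * t)‖ ≤ 2 / |x| := by
  have hx' : Complex.I * x ≠ 0 := by simp [hx]
  rw [integral_exp_mul_complex hx', norm_div, norm_mul, Complex.norm_I, one_mul,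
    Complex.norm_real, Real.norm_eq_abs]
  gcongr
  refine (norm_sub_le _ _).trans ?_
  rw [norm_exp_I_mul, norm_exp_I_mul]; norm_num

theorem integral_norm_sq_expSum (S : Finset ℝ) (a : ℝ → ℂ) (T : ℝ) :
    ((∫ t in (0 : ℝ)..T, ‖expSum S a t‖ ^ 2 : ℝ) : ℂ) = ∑ l ∈ S, ∑ m ∈ S,
      a l * conj (a m) * ∫ t in (0 : ℝ)..T, Complex.exp (Complex.I * (l - m : ℝ) * t) := by
  have h (t : ℝ) : ((‖expSum S a t‖ ^ 2 : ℝ) : ℂ) = ∑ l ∈ S, ∑ m ∈ S,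
      a l * conj (a m) * Complex.exp (Complex.I * (l - m : ℝ) * t) := by
    rw [Complex.ofReal_pow, ← Complex.mul_conj', expSum, map_sum, Finset.sum_mul_sum]
    refine Finset.sum_congr rfl fun l _ => Finset.sum_congr rfl fun m _ => ?_
    rw [map_mul, ← Complex.exp_conj, mul_mul_mul_comm, ← Complex.exp_add]
    congr 2
    simp only [map_mul, Complex.conj_I, Complex.conj_ofReal]
    push_cast; ring
  rw [← intervalIntegral.integral_ofReal]
  simp only [h]
  rw [intervalIntegral.integral_finsetSum fun l _ =>
    Continuous.intervalIntegrable (by fun_prop) _ _]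
  refine Finset.sum_congr rfl fun l _ => ?_
  rw [intervalIntegral.integral_finsetSum fun l _ =>
    Continuous.intervalIntegrable (by fun_prop) _ _]
  refine Finset.sum_congr rfl fun m _ => ?_
  rw [intervalIntegral.integral_const_mul]

/-- Schur test for the Gram matrix: diagonal entries are `T`, the entry at (l, m) is at most `2/|l -
m|`, and `2|aₗ||aₘ| ≤ |aₗ|² + |aₘ|²` together with the symmetry in l, m reduces everything to row
sums. -/
theorem abs_integral_norm_sq_expSum_sub_le (S : Finset ℝ) (a : ℝ → ℂ) (T : ℝ) {ε : ℝ}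
    (hε : ∀ l ∈ S, ∑ m ∈ S.erase l, 2 / |l - m| ≤ ε) :
    |(∫ t in (0 : ℝ)..T, ‖expSum S a t‖ ^ 2) - T * ∑ l ∈ S, ‖a l‖ ^ 2|
      ≤ ε * ∑ l ∈ S, ‖a l‖ ^ 2 := by
  have h1 : (((∫ t in (0 : ℝ)..T, ‖expSum S a t‖ ^ 2) - T * ∑ l ∈ S, ‖a l‖ ^ 2 : ℝ) : ℂ)
      = ∑ l ∈ S, ∑ m ∈ S.erase l,
        a l * conj (a m) * ∫ t in (0 : ℝ)..T, Complex.exp (Complex.I * (l - m : ℝ) * t) := by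
    rw [Complex.ofReal_sub, integral_norm_sq_expSum]
    push_cast
    rw [Finset.mul_sum, ← Finset.sum_sub_distrib]
    refine Finset.sum_congr rfl fun l hl => ?_
    rw [← Finset.add_sum_erase _ _ hl]
    simp [Complex.mul_conj']; ring
  have h2 (l m : ℝ) (hlm : m ≠ l) :
      ‖a l * conj (a m) * ∫ t in (0 : ℝ)..T, Complex.exp (Complex.I * (l - m : ℝ) * t)‖
        ≤ ‖a l‖ ^ 2 * (1 / |l - m|) + ‖a m‖ ^ 2 * (1 / |l - m|) := by
    rw [norm_mul, norm_mul, RCLike.norm_conj]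
    have h3 := norm_integral_exp_le (sub_ne_zero.2 hlm.symm) T
    have h4 : 0 ≤ 1 / |l - m| := by positivity
    calc _ ≤ ‖a l‖ * ‖a m‖ * (2 / |l - m|) := by gcongr
      _ = (2 * ‖a l‖ * ‖a m‖) * (1 / |l - m|) := by ring
      _ ≤ (‖a l‖ ^ 2 + ‖a m‖ ^ 2) * (1 / |l - m|) :=
          mul_le_mul_of_nonneg_right (two_mul_le_add_sq _ _) h4
      _ = _ := by ring
  have hswap : ∑ l ∈ S, ∑ m ∈ S.erase l, ‖a m‖ ^ 2 * (1 / |l - m|)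
      = ∑ l ∈ S, ∑ m ∈ S.erase l, ‖a l‖ ^ 2 * (1 / |l - m|) := by
    rw [Finset.sum_comm' (t' := S) (s' := fun m => S.erase m)]
    · refine Finset.sum_congr rfl fun l _ => Finset.sum_congr rfl fun m _ => ?_
      rw [abs_sub_comm]
    · intro x y
      simp only [Finset.mem_erase]
      tauto
  rw [← Real.norm_eq_abs, ← Complex.norm_real, h1]
  calc _ ≤ ∑ l ∈ S, ∑ m ∈ S.erase l,
        (‖a l‖ ^ 2 * (1 / |l - m|) + ‖a m‖ ^ 2 * (1 / |l - m|)) :=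
        (norm_sum_le _ _).trans <| Finset.sum_le_sum fun l _ => (norm_sum_le _ _).trans <|
          Finset.sum_le_sum fun m hm => h2 l m (Finset.ne_of_mem_erase hm)
    _ = ∑ l ∈ S, ‖a l‖ ^ 2 * ∑ m ∈ S.erase l, 2 / |l - m| := by
        simp only [Finset.sum_add_distrib]
        rw [hswap, ← Finset.sum_add_distrib]
        refine Finset.sum_congr rfl fun l _ => ?_
        rw [← Finset.sum_add_distrib, Finset.mul_sum]
        refine Finset.sum_congr rfl fun m _ => ?_
        ring
    _ ≤ ∑ l ∈ S, ‖a l‖ ^ 2 * ε :=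
        Finset.sum_le_sum fun l hl => mul_le_mul_of_nonneg_left (hε l hl) (by positivity)
    _ = _ := by rw [← Finset.sum_mul, mul_comm]

theorem riesz_of_schur {Λ : Set ℝ} {T ε : ℝ} (hε : 0 ≤ ε) (hεT : ε < T)
    (h : ∀ S : Finset ℝ, ↑S ⊆ Λ → ∀ l ∈ S, ∑ m ∈ S.erase l, 2 / |l - m| ≤ ε) : RieszOn Λ T := by
  refine ⟨T - ε, T + ε, by linarith, by linarith, fun S hS a => ?_⟩
  have := abs_le.1 (abs_integral_norm_sq_expSum_sub_le S a T (h S hS))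
  constructor <;> linarith

/-! ### Adding finitely many frequencies by averaging -/

theorem norm_integral_sq_le {f : ℝ → ℂ} (hf : Continuous f) {a b : ℝ} (hab : a < b) :
    ‖∫ t in a..b, f t‖ ^ 2 ≤ (b - a) * ∫ t in a..b, ‖f t‖ ^ 2 := by
  have hba : 0 < b - a := sub_pos.2 hab
  set J := ∫ t in a..b, ‖f t‖ with hJ
  have h1 : ‖∫ t in a..b, f t‖ ≤ J := intervalIntegral.norm_integral_le_integral_norm hab.le
  -- Cauchy–Schwarz is obtained by expanding the variance of `‖f‖` over the interval.
  have h2 : 0 ≤ ∫ t in a..b, (‖f t‖ - J / (b - a)) ^ 2 :=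
    intervalIntegral.integral_nonneg hab.le fun _ _ => sq_nonneg _
  have h3 : ∫ t in a..b, (‖f t‖ - J / (b - a)) ^ 2
      = (∫ t in a..b, ‖f t‖ ^ 2) - 2 * (J / (b - a)) * J + (J / (b - a)) ^ 2 * (b - a) := by
    have : ∀ t, (‖f t‖ - J / (b - a)) ^ 2
        = ‖f t‖ ^ 2 - 2 * (J / (b - a)) * ‖f t‖ + (J / (b - a)) ^ 2 := fun t => by ring
    simp only [this]
    rw [intervalIntegral.integral_add (Continuous.intervalIntegrable (by fun_prop) _ _)
        (Continuous.intervalIntegrable (by fun_prop) _ _),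
      intervalIntegral.integral_sub (Continuous.intervalIntegrable (by fun_prop) _ _)
        (Continuous.intervalIntegrable (by fun_prop) _ _), intervalIntegral.integral_const_mul,
      intervalIntegral.integral_const, smul_eq_mul, ← hJ]
    ring
  have h4 : J ^ 2 ≤ (b - a) * ∫ t in a..b, ‖f t‖ ^ 2 := by
    rw [h3] at h2
    have h5 := mul_nonneg hba.le h2
    have h6 : (b - a) * ((∫ t in a..b, ‖f t‖ ^ 2) - 2 * (J / (b - a)) * J
        + (J / (b - a)) ^ 2 * (b - a)) = (b - a) * (∫ t in a..b, ‖f t‖ ^ 2) - J ^ 2 := by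
      field_simp; ring
    linarith
  exact (pow_le_pow_left₀ (norm_nonneg _) h1 2).trans h4

/-- The mean of `e^{ixt}` over `[0,δ]`. -/
def expMean (δ x : ℝ) : ℂ := (δ : ℂ)⁻¹ * ∫ t in (0 : ℝ)..δ, Complex.exp (Complex.I * x * t)

/-- The real part of the mean is `sin(xδ)/(xδ)`, an even function of x that stays away from 1 once x
stays away from 0. -/
theorem exists_le_norm_one_sub_expMean {δ γ : ℝ} (hδ : 0 < δ) (hγ : 0 < γ) :
    ∃ κ > 0, ∀ x : ℝ, γ ≤ |x| → κ ≤ ‖1 - expMean δ x‖ := by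
  have hy0 : 0 < γ * δ := by positivity
  set y₀ := γ * δ
  have hpos : 0 < y₀ - Real.sin y₀ := sub_pos.2 (Real.sin_lt hy0)
  have hmono : Monotone fun y : ℝ => y - Real.sin y := by
    refine monotone_of_deriv_nonneg (by fun_prop) fun y => ?_
    have : deriv (fun y : ℝ => y - Real.sin y) y = 1 - Real.cos y := by
      rw [deriv_fun_sub (by fun_prop) (by fun_prop)]; simp
    rw [this]
    linarith [Real.cos_le_one y]
  -- For `y ≤ 2` monotonicity of `y - sin y` gives the bound; for `y ≥ 2` already `sin y ≤ 1` does.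
  have key : ∀ y : ℝ, y₀ ≤ y → min ((y₀ - Real.sin y₀) / 2) (1 / 2) ≤ 1 - Real.sin y / y := by
    intro y hy
    have hy' : 0 < y := hy0.trans_le hy
    rcases le_total y 2 with h2 | h2
    · refine (min_le_left _ _).trans ?_
      have h3 : y₀ - Real.sin y₀ ≤ y - Real.sin y := hmono hy
      have h4 : 1 - Real.sin y / y = (y - Real.sin y) / y := by field_simp
      rw [h4, div_le_div_iff₀ (by norm_num) hy']
      nlinarith
    · refine (min_le_right _ _).trans ?_
      have : Real.sin y / y ≤ 1 / 2 := by
        rw [div_le_div_iff₀ hy' (by norm_num)]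
        linarith [Real.sin_le_one y]
      linarith
  refine ⟨min ((y₀ - Real.sin y₀) / 2) (1 / 2), by positivity, fun x hx => ?_⟩
  have hx0 : x ≠ 0 := by
    rintro rfl
    rw [abs_zero] at hx
    linarith
  have hre : (1 - expMean δ x).re = 1 - Real.sin (|x| * δ) / (|x| * δ) := by
    have e1 : Real.sin (|x| * δ) / (|x| * δ) = Real.sin (x * δ) / (x * δ) := by
      rcases abs_cases x with h | h <;> rw [h.1]
      rw [neg_mul, Real.sin_neg, neg_div_neg_eq]
    have e2 : expMean δ x
        = (Complex.exp ((x * δ : ℝ) * Complex.I) - 1) * (-Complex.I) * ((x * δ : ℝ)⁻¹ : ℝ) := by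
      have hx' : Complex.I * x ≠ 0 := by simp [hx0]
      rw [expMean, integral_exp_mul_complex hx']
      have : (x : ℂ) ≠ 0 := by exact_mod_cast hx0
      have : (δ : ℂ) ≠ 0 := by exact_mod_cast hδ.ne'
      have e3 : Complex.I * x * δ = (x * δ : ℝ) * Complex.I := by push_cast; ring
      rw [e3]
      push_cast
      field_simp
      simp only [mul_zero, Complex.exp_zero, Complex.I_sq]; ring
    rw [Complex.sub_re, Complex.one_re, e1, e2, Complex.re_mul_ofReal, Complex.exp_mul_I,
      ← Complex.ofReal_cos, ← Complex.ofReal_sin]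
    simp only [Complex.mul_re, Complex.sub_re, Complex.add_re, Complex.ofReal_re, Complex.I_re,
      Complex.neg_re, Complex.neg_im, Complex.I_im, Complex.ofReal_im, Complex.sub_im,
      Complex.add_im, Complex.mul_im, Complex.one_re, Complex.one_im]
    ring
  calc _ ≤ 1 - Real.sin (|x| * δ) / (|x| * δ) :=
        key _ (mul_le_mul_of_nonneg_right hx hδ.le)
    _ = (1 - expMean δ x).re := hre.symm
    _ ≤ _ := Complex.re_le_norm _

theorem integral_shifted_exp (δ μ l t : ℝ) :
    (δ : ℂ)⁻¹ * ∫ σ in (0 : ℝ)..δ, Complex.exp (-(Complex.I * μ * σ)) *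
      Complex.exp (Complex.I * l * (t + σ : ℝ))
      = expMean δ (l - μ) * Complex.exp (Complex.I * l * t) := by
  have h (σ : ℝ) : Complex.exp (-(Complex.I * μ * σ)) * Complex.exp (Complex.I * l * (t + σ : ℝ))
      = Complex.exp (Complex.I * (l - μ : ℝ) * σ) * Complex.exp (Complex.I * l * t) := by
    rw [← Complex.exp_add, ← Complex.exp_add]
    congr 1
    push_cast; ring
  simp only [h]
  rw [intervalIntegral.integral_mul_const, expMean]; ring

theorem expMean_zero {δ : ℝ} (hδ : δ ≠ 0) : expMean δ 0 = 1 := by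
  have : (δ : ℂ) ≠ 0 := by exact_mod_cast hδ
  simp [expMean, this]

/-- Averaging against `e^{-iμσ}` removes the frequency `μ`. -/
theorem sub_average_eq (S : Finset ℝ) (a : ℝ → ℂ) (b : ℂ) {δ : ℝ} (hδ : δ ≠ 0) (μ t : ℝ) :
    (b * Complex.exp (Complex.I * μ * t) + expSum S a t) -
      (δ : ℂ)⁻¹ * ∫ σ in (0 : ℝ)..δ, Complex.exp (-(Complex.I * μ * σ)) *
        (b * Complex.exp (Complex.I * μ * (t + σ : ℝ)) + expSum S a (t + σ))
      = expSum S (fun l => a l * (1 - expMean δ (l - μ))) t := by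
  have h (σ : ℝ) : Complex.exp (-(Complex.I * μ * σ)) *
        (b * Complex.exp (Complex.I * μ * (t + σ : ℝ)) + expSum S a (t + σ))
      = b * (Complex.exp (-(Complex.I * μ * σ)) * Complex.exp (Complex.I * μ * (t + σ : ℝ)))
        + ∑ l ∈ S, a l * (Complex.exp (-(Complex.I * μ * σ)) *
          Complex.exp (Complex.I * l * (t + σ : ℝ))) := by
    rw [expSum, mul_add, Finset.mul_sum]
    congr 1
    · ring
    · exact Finset.sum_congr rfl fun l _ => by ring
  simp only [h]
  rw [intervalIntegral.integral_add (Continuous.intervalIntegrable (by fun_prop) _ _)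
      (Continuous.intervalIntegrable (by fun_prop) _ _),
    intervalIntegral.integral_finsetSum fun l _ =>
      Continuous.intervalIntegrable (by fun_prop) _ _]
  simp only [intervalIntegral.integral_const_mul]
  rw [mul_add, mul_left_comm, integral_shifted_exp, Finset.mul_sum, sub_self, expMean_zero hδ,
    one_mul, add_sub_add_left_eq_sub, expSum, expSum, ← Finset.sum_sub_distrib]
  refine Finset.sum_congr rfl fun l _ => ?_
  rw [mul_left_comm, integral_shifted_exp]; ring

/-- Subtracting the forward average is bounded from `L²(0,T)` to `L²(0,T-δ)`, by Cauchy–Schwarz in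
the window. The interval shrinks because the average at time t looks ahead up to `t + δ`. -/
theorem integral_norm_sq_sub_average_le {f : ℝ → ℂ} (hf : Continuous f) {T δ : ℝ} (hδ : 0 < δ)
    (hδT : δ ≤ T) (μ : ℝ) (g : ℝ → ℂ) (hgc : Continuous g)
    (hg : ∀ t, g t = f t - (δ : ℂ)⁻¹ * ∫ σ in (0 : ℝ)..δ,
      Complex.exp (-(Complex.I * μ * σ)) * f (t + σ)) :
    ∫ t in (0 : ℝ)..T - δ, ‖g t‖ ^ 2
      ≤ (2 + 2 * (T - δ) / δ) * ∫ t in (0 : ℝ)..T, ‖f t‖ ^ 2 := by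
  set I := ∫ t in (0 : ℝ)..T, ‖f t‖ ^ 2
  have hsub {u v : ℝ} (hu : 0 ≤ u) (huv : u ≤ v) (hv : v ≤ T) : ∫ t in u..v, ‖f t‖ ^ 2 ≤ I :=
    intervalIntegral.integral_mono_interval hu huv hv
      (Eventually.of_forall fun _ => by positivity)
      (Continuous.intervalIntegrable (by fun_prop) _ _)
  have havg (t : ℝ) (ht : t ∈ Set.Icc 0 (T - δ)) :
      ‖(δ : ℂ)⁻¹ * ∫ σ in (0 : ℝ)..δ, Complex.exp (-(Complex.I * μ * σ)) * f (t + σ)‖ ^ 2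
        ≤ I / δ := by
    have h1 := norm_integral_sq_le (f := fun σ : ℝ =>
      Complex.exp (-(Complex.I * μ * σ)) * f (t + σ)) (by fun_prop) hδ
    have h2 (σ : ℝ) : ‖Complex.exp (-(Complex.I * μ * σ)) * f (t + σ)‖ = ‖f (t + σ)‖ := by
      rw [norm_mul, show -(Complex.I * μ * σ) = Complex.I * (-μ : ℝ) * σ by push_cast; ring,
        norm_exp_I_mul, one_mul]
    simp only [h2] at h1
    rw [intervalIntegral.integral_comp_add_left (fun σ => ‖f σ‖ ^ 2)] at h1
    have h3 := hsub (u := t + 0) (v := t + δ) (by linarith [ht.1]) (by linarith)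
      (by linarith [ht.2])
    rw [norm_mul, mul_pow, norm_inv, Complex.norm_real, Real.norm_of_nonneg hδ.le]
    calc _ ≤ δ⁻¹ ^ 2 * ((δ - 0) * I) := by
          gcongr
          exact h1.trans (mul_le_mul_of_nonneg_left h3 (by linarith))
      _ = I / δ := by field_simp; ring
  have hpt (t : ℝ) (ht : t ∈ Set.Icc 0 (T - δ)) : ‖g t‖ ^ 2 ≤ 2 * ‖f t‖ ^ 2 + 2 * (I / δ) := by
    have h1 := havg t ht
    rw [hg]
    have h2 := norm_sub_le (f t) ((δ : ℂ)⁻¹ * ∫ σ in (0 : ℝ)..δ,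
      Complex.exp (-(Complex.I * μ * σ)) * f (t + σ))
    have h3 := pow_le_pow_left₀ (norm_nonneg _) h2 2
    have h4 := add_sq_le (a := ‖f t‖) (b := ‖(δ : ℂ)⁻¹ * ∫ σ in (0 : ℝ)..δ,
      Complex.exp (-(Complex.I * μ * σ)) * f (t + σ)‖)
    linarith
  calc _ ≤ ∫ t in (0 : ℝ)..T - δ, (2 * ‖f t‖ ^ 2 + 2 * (I / δ)) :=
        intervalIntegral.integral_mono_on (by linarith)
          (Continuous.intervalIntegrable (by fun_prop) _ _)
          (Continuous.intervalIntegrable (by fun_prop) _ _) hpt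
    _ = 2 * (∫ t in (0 : ℝ)..T - δ, ‖f t‖ ^ 2) + 2 * (T - δ) / δ * I := by
        rw [intervalIntegral.integral_add (Continuous.intervalIntegrable (by fun_prop) _ _)
          (Continuous.intervalIntegrable (by fun_prop) _ _), intervalIntegral.integral_const_mul,
          intervalIntegral.integral_const, smul_eq_mul]
        ring
    _ ≤ 2 * I + 2 * (T - δ) / δ * I := by
        have := hsub le_rfl (v := T - δ) (by linarith) (by linarith)
        linarith
    _ = _ := by ring

theorem integral_norm_sq_add_le {f g : ℝ → ℂ} (hf : Continuous f) (hg : Continuous g) {T : ℝ}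
    (hT : 0 ≤ T) : ∫ t in (0 : ℝ)..T, ‖f t + g t‖ ^ 2
      ≤ 2 * (∫ t in (0 : ℝ)..T, ‖f t‖ ^ 2) + 2 * ∫ t in (0 : ℝ)..T, ‖g t‖ ^ 2 := by
  rw [← intervalIntegral.integral_const_mul, ← intervalIntegral.integral_const_mul,
    ← intervalIntegral.integral_add (Continuous.intervalIntegrable (by fun_prop) _ _)
      (Continuous.intervalIntegrable (by fun_prop) _ _)]
  refine intervalIntegral.integral_mono_on hT (Continuous.intervalIntegrable (by fun_prop) _ _)
    (Continuous.intervalIntegrable (by fun_prop) _ _) fun t _ => ?_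
  have h3 := pow_le_pow_left₀ (norm_nonneg _) (norm_add_le (f t) (g t)) 2
  have h4 := add_sq_le (a := ‖f t‖) (b := ‖g t‖)
  linarith

theorem integral_norm_sq_mul_exp (b : ℂ) (μ T : ℝ) :
    ∫ t in (0 : ℝ)..T, ‖b * Complex.exp (Complex.I * μ * t)‖ ^ 2 = T * ‖b‖ ^ 2 := by
  simp only [norm_mul, norm_exp_I_mul, mul_one]
  simp

/-- One frequency at a positive distance can be added to a Riesz sequence of exponentials. -/
theorem riesz_insert {Λ : Set ℝ} {T₀ : ℝ} (hT₀ : 0 ≤ T₀) (h : ∀ T > T₀, RieszOn Λ T) {μ γ : ℝ}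
    (hγ : 0 < γ) (hμ : ∀ l ∈ Λ, γ ≤ |l - μ|) : ∀ T > T₀, RieszOn (insert μ Λ) T := by
  intro T hT
  have hT0 : 0 < T := hT₀.trans_lt hT
  -- The window takes half of the spare time, so the old family is still Riesz on `[0, T - δ]`.
  set δ := (T - T₀) / 2 with hδdef
  have hδ : 0 < δ := by rw [hδdef]; linarith
  have hδT : T₀ < T - δ := by rw [hδdef]; linarith
  obtain ⟨c, _, hc, _, H⟩ := h (T - δ) hδT
  obtain ⟨_, C, _, hC, H'⟩ := h T hT
  obtain ⟨κ, hκ, hκle⟩ := exists_le_norm_one_sub_expMean hδ hγ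
  set K := 2 + 2 * (T - δ) / δ with hK
  have hK0 : 0 < K := by
    have : 0 < T - δ := by linarith
    positivity
  -- `A` controls the old coefficients, through the averaged sum in which μ has disappeared and each
  -- old coefficient has kept at least a factor κ. `B` then controls the coefficient of μ, by
  -- subtracting the old sum and using its upper Riesz bound on all of `[0, T]`.
  set A := K / (c * κ ^ 2) with hA
  have hA0 : 0 < A := by positivity
  set B := (2 + 2 * C * A) / T with hB
  have hB0 : 0 < B := by positivity
  have main : ∀ S : Finset ℝ, ↑S ⊆ Λ → ∀ (a : ℝ → ℂ) (b : ℂ),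
      (A + B)⁻¹ * (‖b‖ ^ 2 + ∑ l ∈ S, ‖a l‖ ^ 2)
        ≤ ∫ t in (0 : ℝ)..T, ‖b * Complex.exp (Complex.I * μ * t) + expSum S a t‖ ^ 2 ∧
      ∫ t in (0 : ℝ)..T, ‖b * Complex.exp (Complex.I * μ * t) + expSum S a t‖ ^ 2
        ≤ (2 * T + 2 * C) * (‖b‖ ^ 2 + ∑ l ∈ S, ‖a l‖ ^ 2) := by
    intro S hS a b
    have hs0 : 0 ≤ ∑ l ∈ S, ‖a l‖ ^ 2 := Finset.sum_nonneg fun _ _ => by positivity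
    set I := ∫ t in (0 : ℝ)..T, ‖b * Complex.exp (Complex.I * μ * t) + expSum S a t‖ ^ 2 with hI
    constructor
    · have h1 := integral_norm_sq_sub_average_le (T := T)
        (f := fun t : ℝ => b * Complex.exp (Complex.I * μ * t) + expSum S a t) (by fun_prop) hδ
        (by linarith) μ _ (continuous_expSum S fun l => a l * (1 - expMean δ (l - μ)))
        (fun t => (sub_average_eq S a b hδ.ne' μ t).symm)
      have h2 := (H S hS fun l => a l * (1 - expMean δ (l - μ))).1
      have h3 : κ ^ 2 * ∑ l ∈ S, ‖a l‖ ^ 2 ≤ ∑ l ∈ S, ‖a l * (1 - expMean δ (l - μ))‖ ^ 2 := by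
        rw [Finset.mul_sum]
        refine Finset.sum_le_sum fun l hl => ?_
        rw [norm_mul, mul_pow, mul_comm]
        have := hκle _ (hμ l (hS hl))
        gcongr
      have h4 : ∑ l ∈ S, ‖a l‖ ^ 2 ≤ A * I := by
        rw [hA, div_mul_eq_mul_div, le_div_iff₀ (by positivity)]
        calc _ = c * (κ ^ 2 * ∑ l ∈ S, ‖a l‖ ^ 2) := by ring
          _ ≤ c * ∑ l ∈ S, ‖a l * (1 - expMean δ (l - μ))‖ ^ 2 := by gcongr
          _ ≤ _ := h2.trans h1
      have h5 : ‖b‖ ^ 2 ≤ B * I := by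
        have h6 := integral_norm_sq_add_le
          (f := fun t : ℝ => b * Complex.exp (Complex.I * μ * t) + expSum S a t)
          (g := fun t : ℝ => -expSum S a t) (by fun_prop) (by fun_prop) hT0.le
        simp only [add_neg_cancel_right, norm_neg] at h6
        rw [integral_norm_sq_mul_exp] at h6
        have h7 := (H' S hS a).2
        rw [hB, div_mul_eq_mul_div, le_div_iff₀ hT0]
        have h8 : C * ∑ l ∈ S, ‖a l‖ ^ 2 ≤ C * (A * I) := by gcongr
        linarith
      rw [inv_mul_le_iff₀ (by positivity)]
      linarith
    · have h6 := integral_norm_sq_add_le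
        (f := fun t : ℝ => b * Complex.exp (Complex.I * μ * t))
        (g := expSum S a) (by fun_prop) (by fun_prop) hT0.le
      rw [integral_norm_sq_mul_exp] at h6
      have h7 := (H' S hS a).2
      refine h6.trans ?_
      nlinarith [mul_nonneg hT0.le hs0, mul_nonneg hC.le (sq_nonneg ‖b‖)]
  refine ⟨(A + B)⁻¹, 2 * T + 2 * C, by positivity, by positivity, fun S hS a => ?_⟩
  by_cases hmem : μ ∈ S
  · have := main (S.erase μ) (fun l hl => by
      rw [Finset.coe_erase] at hl
      exact (hS hl.1).resolve_left hl.2) a (a μ)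
    simp only [expSum] at this ⊢
    have e1 (t : ℝ) : a μ * Complex.exp (Complex.I * μ * t)
        + ∑ l ∈ S.erase μ, a l * Complex.exp (Complex.I * l * t)
        = ∑ l ∈ S, a l * Complex.exp (Complex.I * l * t) :=
      Finset.add_sum_erase S (fun l : ℝ => a l * Complex.exp (Complex.I * l * t)) hmem
    simp only [e1] at this
    rwa [Finset.add_sum_erase S (fun l => ‖a l‖ ^ 2) hmem] at this
  · have := main S (fun l hl => (hS hl).resolve_left fun h => hmem (h ▸ hl)) a 0
    simpa using this

/-- Induction on `F`. The threshold `T₀` does not move, because each insertion turns validity for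
all `T > T₀` into validity for all `T > T₀`. -/
theorem riesz_union_finset {Λ : Set ℝ} {T₀ : ℝ} (hT₀ : 0 ≤ T₀) (h : ∀ T > T₀, RieszOn Λ T)
    (F : Finset ℝ) (hF : ∀ μ ∈ F, ∃ γ > 0, ∀ l ∈ Λ ∪ ↑F, l ≠ μ → γ ≤ |l - μ|) :
    ∀ T > T₀, RieszOn (Λ ∪ ↑F) T := by
  induction F using Finset.induction_on with
  | empty => simpa using h
  | insert μ F hμF ih =>
    have hsub : Λ ∪ ↑F ⊆ Λ ∪ ↑(insert μ F) :=
      Set.union_subset_union_right _ (by simp)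
    have ih' := ih fun ν hν => by
      obtain ⟨γ, hγ, H⟩ := hF ν (Finset.mem_insert_of_mem hν)
      exact ⟨γ, hγ, fun l hl => H l (hsub hl)⟩
    have e : Λ ∪ ↑(insert μ F) = insert μ (Λ ∪ ↑F) := by
      rw [Finset.coe_insert, Set.union_insert]
    rw [e]
    by_cases hμ : μ ∈ Λ ∪ ↑F
    · rwa [Set.insert_eq_of_mem hμ]
    · obtain ⟨γ, hγ, H⟩ := hF μ (Finset.mem_insert_self _ _)
      exact riesz_insert hT₀ ih' hγ fun l hl => H l (hsub hl) fun h => hμ (h ▸ hl)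

/-- Insertion starting from the empty family with threshold 0. It serves below to show that a
trigonometric polynomial is determined by its values on an arc. -/
theorem riesz_finset (F : Finset ℝ) {T : ℝ} (hT : 0 < T) : RieszOn (↑F : Set ℝ) T := by
  have h0 : ∀ T > (0 : ℝ), RieszOn ∅ T := fun T hT =>
    riesz_of_schur le_rfl hT fun S hS l hl => absurd (hS hl) (by simp)
  have := riesz_union_finset le_rfl h0 F (fun μ _ => ?_) T hT
  · simpa using this
  · rcases (F.erase μ).eq_empty_or_nonempty with he | hne
    · refine ⟨1, one_pos, fun l hl hlμ => ?_⟩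
      have : l ∈ F.erase μ := Finset.mem_erase.2 ⟨hlμ, by simpa using hl⟩
      simp [he] at this
    · obtain ⟨m, hm, hmin⟩ := (F.erase μ).exists_min_image (fun l => |l - μ|) hne
      refine ⟨|m - μ|, abs_pos.2 (sub_ne_zero.2 (Finset.ne_of_mem_erase hm)), fun l hl hlμ => ?_⟩
      exact hmin l (Finset.mem_erase.2 ⟨hlμ, by simpa using hl⟩)

/-! ### Spacing of the eigenvalues and the Riesz property -/

/-- The cubic part gives `|x - y|(x² + xy + y²)` with `x² + xy + y² ≥ (x² + y²)/2`, while `x|x|`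
varies by at most `|x - y|(|x| + |y|)`. For large indices the cubic part wins. -/
theorem abs_eigenvalue_sub_ge {α : ℝ} (hα : 0 < α) (k j : ℤ) :
    |(k : ℝ) - j| * (((k : ℝ) ^ 2 + (j : ℝ) ^ 2) / 2 - α * (|(k : ℝ)| + |(j : ℝ)|))
      ≤ |eigenvalue α k - eigenvalue α j| := by
  set x := (k : ℝ)
  set y := (j : ℝ)
  have h1 : |x - y| * ((x ^ 2 + y ^ 2) / 2) ≤ |x ^ 3 - y ^ 3| := by
    rw [show x ^ 3 - y ^ 3 = (x - y) * (x ^ 2 + x * y + y ^ 2) by ring, abs_mul]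
    gcongr
    refine le_trans ?_ (le_abs_self _)
    nlinarith [sq_nonneg (x + y)]
  have h2 : abs (x * |x| - y * |y|) ≤ |x - y| * (|x| + |y|) := by
    have e : x * |x| - y * |y| = (x - y) * |x| + y * (|x| - |y|) := by ring
    calc _ ≤ abs ((x - y) * |x|) + abs (y * (|x| - |y|)) := by rw [e]; exact abs_add_le _ _
      _ = |x - y| * |x| + |y| * abs (|x| - |y|) := by simp [abs_mul]
      _ ≤ |x - y| * |x| + |y| * |x - y| := by
          exact add_le_add le_rfl
            (mul_le_mul_of_nonneg_left (abs_abs_sub_abs_le x y) (abs_nonneg _))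
      _ = _ := by ring
  have h3 : eigenvalue α k - eigenvalue α j = (x ^ 3 - y ^ 3) - α * (x * |x| - y * |y|) := by
    simp only [eigenvalue]; ring
  have h4 := abs_sub_abs_le_abs_sub (x ^ 3 - y ^ 3) (α * (x * |x| - y * |y|))
  rw [← h3, abs_mul, abs_of_pos hα] at h4
  nlinarith [mul_le_mul_of_nonneg_left h2 hα.le]

theorem one_le_abs_intCast_sub {k j : ℤ} (h : k ≠ j) : (1 : ℝ) ≤ |(k : ℝ) - j| := by
  have : 1 ≤ |k - j| := Int.one_le_abs (sub_ne_zero.2 h)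
  exact_mod_cast this

/-- The gap is quadratic in `k - j` with a factor of order N, so the inverse gaps in a row are
summable with total of order `1/N`. -/
theorem eigenvalue_gap_tail {α N : ℝ} (hα : 0 < α) (hN : 4 * α ≤ N) {k j : ℤ}
    (hk : N ≤ |(k : ℝ)|) (hj : N ≤ |(j : ℝ)|) :
    N / 4 * ((k : ℝ) - j) ^ 2 ≤ |eigenvalue α k - eigenvalue α j| := by
  refine le_trans ?_ (abs_eigenvalue_sub_ge hα k j)
  rw [← sq_abs ((k : ℝ) - j), ← sq_abs (k : ℝ), ← sq_abs (j : ℝ)]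
  have h1 := abs_sub (k : ℝ) (j : ℝ)
  set u := |(k : ℝ)|
  set v := |(j : ℝ)|
  set w := |(k : ℝ) - j|
  have hw : 0 ≤ w := abs_nonneg _
  have h2 : N / 4 * w ≤ (u ^ 2 + v ^ 2) / 2 - α * (u + v) := by nlinarith
  calc _ = w * (N / 4 * w) := by ring
    _ ≤ _ := mul_le_mul_of_nonneg_left h2 hw

theorem exists_eigenvalue_near {α : ℝ} (hα : 0 < α) (j : ℤ) :
    ∃ N : ℕ, ∀ k : ℤ, (N : ℝ) < |(k : ℝ)| → k ≠ j →
      1 ≤ |eigenvalue α k - eigenvalue α j| := by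
  -- Completing the square in `v = |j|` costs at most `α²/2` whatever j is; the threshold lets the
  -- part in `u = |k|` absorb this and leave 1.
  obtain ⟨N, hN⟩ := exists_nat_ge (4 * α + 2 + α ^ 2)
  refine ⟨N, fun k hk hkj => le_trans ?_ (abs_eigenvalue_sub_ge hα k j)⟩
  have h1 := one_le_abs_intCast_sub hkj
  rw [← sq_abs (k : ℝ), ← sq_abs (j : ℝ)]
  set u := |(k : ℝ)|
  set v := |(j : ℝ)|
  have h2 : 1 ≤ (u ^ 2 + v ^ 2) / 2 - α * (u + v) := by
    nlinarith [sq_nonneg (v - α), sq_nonneg α]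
  nlinarith

/-- For large `|k|` the eigenvalue `λₖ` is simple; the threshold does not depend on `j`. -/
theorem exists_eigenvalue_simple {α : ℝ} (hα : 0 < α) :
    ∃ N : ℕ, ∀ k j : ℤ, (N : ℝ) < |(k : ℝ)| → eigenvalue α j = eigenvalue α k → j = k := by
  obtain ⟨N, hN⟩ := exists_nat_ge (4 * α + 2 + α ^ 2)
  refine ⟨N, fun k j hk hkj => ?_⟩
  by_contra hne
  have h0 := abs_eigenvalue_sub_ge hα k j
  have h1 := one_le_abs_intCast_sub (Ne.symm hne)
  rw [hkj, sub_self, abs_zero, ← sq_abs (k : ℝ), ← sq_abs (j : ℝ)] at h0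
  set u := |(k : ℝ)|
  set v := |(j : ℝ)|
  have h2 : 1 ≤ (u ^ 2 + v ^ 2) / 2 - α * (u + v) := by
    nlinarith [sq_nonneg (v - α), sq_nonneg α]
  nlinarith

theorem finite_abs_le (N : ℕ) : {k : ℤ | |(k : ℝ)| ≤ N}.Finite := by
  refine (Set.finite_Icc (-(N : ℤ)) N).subset fun k hk => ?_
  have : |k| ≤ N := by
    have h : |(k : ℝ)| ≤ N := hk
    exact_mod_cast h
  exact abs_le.1 this

/-- Only finitely many indices can give an eigenvalue within distance 1, and over those the minimal
nonzero distance is attained. -/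
theorem eigenvalue_isolated {α : ℝ} (hα : 0 < α) (j : ℤ) :
    ∃ γ > 0, ∀ k : ℤ, eigenvalue α k ≠ eigenvalue α j →
      γ ≤ |eigenvalue α k - eigenvalue α j| := by
  classical
  obtain ⟨N, hN⟩ := exists_eigenvalue_near hα j
  set F := (finite_abs_le N).toFinset.filter fun k => eigenvalue α k ≠ eigenvalue α j
  have hlarge {k : ℤ} (hk : eigenvalue α k ≠ eigenvalue α j) (hkF : k ∉ F) :
      1 ≤ |eigenvalue α k - eigenvalue α j| := by
    refine hN k ?_ fun h => hk (h ▸ rfl)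
    by_contra! hle
    exact hkF (by simp [F, hk, hle])
  rcases F.eq_empty_or_nonempty with he | hne
  · exact ⟨1, one_pos, fun k hk => hlarge hk (by simp [he])⟩
  · obtain ⟨m, hm, hmin⟩ := F.exists_min_image
      (fun k => |eigenvalue α k - eigenvalue α j|) hne
    refine ⟨min 1 |eigenvalue α m - eigenvalue α j|, ?_, fun k hk => ?_⟩
    · have := (Finset.mem_filter.1 hm).2
      have := abs_pos.2 (sub_ne_zero.2 this)
      positivity
    · by_cases hkF : k ∈ F
      · exact (min_le_right _ _).trans (hmin k hkF)
      · exact (min_le_left _ _).trans (hlarge hk hkF)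

theorem riesz_eigenvalue_tail {α T : ℝ} (hα : 0 < α) (hT : 0 < T) :
    ∃ N : ℕ, ∀ T' ≥ T, RieszOn (eigenvalue α '' {k | (N : ℝ) < |(k : ℝ)|}) T' := by
  classical
  have hsum : Summable fun m : ℤ => 1 / (m : ℝ) ^ 2 :=
    Real.summable_one_div_int_pow.2 (by norm_num)
  set A := ∑' m : ℤ, 1 / (m : ℝ) ^ 2
  have hA : 0 ≤ A := tsum_nonneg fun _ => by positivity
  -- The term `4 * α` is what the gap estimate needs; `16 * A / T` brings the row sums `8 * A / N`
  -- below `T`.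
  obtain ⟨N, hN⟩ := exists_nat_ge (4 * α + 16 * A / T)
  have hN1 : 4 * α ≤ N := by
    have : 0 ≤ 16 * A / T := by positivity
    linarith
  have hN0 : (0 : ℝ) < N := by linarith
  refine ⟨N, fun T' hT' => riesz_of_schur (ε := 8 * A / N) (by positivity) ?_ ?_⟩
  · refine lt_of_lt_of_le ?_ hT'
    rw [div_lt_iff₀ hN0]
    have h1 : 16 * A / T * T = 16 * A := by field_simp
    nlinarith
  · intro S hS l hl
    obtain ⟨k, hk, rfl⟩ := hS hl
    -- Each frequency in `S` gets an integer index, with 0 as an irrelevant default elsewhere. The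
    -- differences from k are then distinct integers, so the row sum is dominated by `∑ 1/n²`.
    have hex : ∀ m : ℝ, ∃ j : ℤ, m ∈ S → eigenvalue α j = m ∧ (N : ℝ) < |(j : ℝ)| := fun m => by
      by_cases hm : m ∈ S
      · obtain ⟨j, hj, rfl⟩ := hS hm
        exact ⟨j, fun _ => ⟨rfl, hj⟩⟩
      · exact ⟨0, fun h => absurd h hm⟩
    choose r hr using hex
    have hinj : Set.InjOn (fun m => k - r m) (S.erase (eigenvalue α k) : Finset ℝ) := by
      intro m hm n hn hmn
      have h1 := (hr m (Finset.mem_of_mem_erase hm)).1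
      have h2 := (hr n (Finset.mem_of_mem_erase hn)).1
      rw [← h1, ← h2, sub_right_injective hmn]
    have hterm : ∀ m ∈ S.erase (eigenvalue α k),
        2 / |eigenvalue α k - m| ≤ 8 / N * (1 / ((k - r m : ℤ) : ℝ) ^ 2) := by
      intro m hm
      obtain ⟨h1, h2⟩ := hr m (Finset.mem_of_mem_erase hm)
      have hne : k ≠ r m := fun h => Finset.ne_of_mem_erase hm (by rw [← h1, ← h])
      have h3 := eigenvalue_gap_tail hα hN1 (le_of_lt hk) h2.le
      rw [h1] at h3
      have h4 : 0 < ((k : ℝ) - r m) ^ 2 := by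
        have := one_le_abs_intCast_sub hne
        rw [← sq_abs]; positivity
      calc _ ≤ 2 / (N / 4 * ((k : ℝ) - r m) ^ 2) := by gcongr
        _ = _ := by push_cast; field_simp; norm_num
    calc _ ≤ ∑ m ∈ S.erase (eigenvalue α k), 8 / N * (1 / ((k - r m : ℤ) : ℝ) ^ 2) :=
          Finset.sum_le_sum hterm
      _ = 8 / N * ∑ n ∈ (S.erase (eigenvalue α k)).image (fun m => k - r m),
            1 / (n : ℝ) ^ 2 := by
          rw [← Finset.mul_sum, Finset.sum_image hinj]
      _ ≤ 8 / N * A := by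
          gcongr
          exact hsum.sum_le_tsum _ fun _ _ => by positivity
      _ = _ := by ring

/-- The tail is Riesz already at time `T/2`; the other half of the time pays for inserting the
finitely many low eigenvalues, each of which is isolated. -/
theorem riesz_eigenvalue {α T : ℝ} (hα : 0 < α) (hT : 0 < T) :
    RieszOn (Set.range (eigenvalue α)) T := by
  classical
  obtain ⟨N, hN⟩ := riesz_eigenvalue_tail hα (half_pos hT)
  set Λ := eigenvalue α '' {k | (N : ℝ) < |(k : ℝ)|}
  set F := (finite_abs_le N).toFinset.image (eigenvalue α)
  have hsub : Λ ∪ ↑F ⊆ Set.range (eigenvalue α) := by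
    rintro _ (⟨k, -, rfl⟩ | h)
    · exact ⟨k, rfl⟩
    · obtain ⟨k, -, rfl⟩ := Finset.mem_image.1 h
      exact ⟨k, rfl⟩
  refine (riesz_union_finset (half_pos hT).le (fun T' hT' => hN T' hT'.le) F ?_ T
    (half_lt_self hT)).mono ?_
  · intro μ hμ
    obtain ⟨j, -, rfl⟩ := Finset.mem_image.1 hμ
    obtain ⟨γ, hγ, H⟩ := eigenvalue_isolated hα j
    refine ⟨γ, hγ, fun l hl hne => ?_⟩
    obtain ⟨k, rfl⟩ := hsub hl
    exact H k hne
  · rintro _ ⟨k, rfl⟩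
    rcases lt_or_ge (N : ℝ) |(k : ℝ)| with h | h
    · exact Or.inl ⟨k, h, rfl⟩
    · exact Or.inr (Finset.mem_image.2 ⟨k, by simpa using h, rfl⟩)

/-! ### The dual family -/

/-- A uniformly minimal family in a Hilbert space has a bounded biorthogonal family in its closed
span. -/
theorem exists_biorthogonal {H ι : Type*} [NormedAddCommGroup H] [InnerProductSpace ℂ H]
    [CompleteSpace H] (v : ι → H) {c : ℝ} (hc : 0 < c)
    (h : ∀ (S : Finset ι) (a : ι → ℂ), ∀ i ∈ S, c * ‖a i‖ ≤ ‖∑ i ∈ S, a i • v i‖) (i : ι) :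
    ∃ q ∈ (Submodule.span ℂ (Set.range v)).topologicalClosure,
      inner ℂ q (v i) = 1 ∧ (∀ j ≠ i, inner ℂ q (v j) = 0) ∧ ‖q‖ ≤ 1 / c := by
  classical
  set W := Submodule.span ℂ (v '' {i}ᶜ)
  set M := W.topologicalClosure
  have hWle : M ≤ (Submodule.span ℂ (Set.range v)).topologicalClosure :=
    Submodule.topologicalClosure_mono (Submodule.span_mono (Set.image_subset_range _ _))
  have : CompleteSpace M := (Submodule.isClosed_topologicalClosure W).completeSpace_coe
  -- The dual vector is `p / ‖p‖²`, with `p` the residual of `v i` after projection onto the closed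
  -- span of the other vectors. Minimality gives `‖p‖ ≥ c`, hence the bound `1/c`.
  set p := v i - M.starProjection (v i)
  have hpM : ∀ w ∈ M, inner ℂ p w = 0 := fun w hw =>
    Submodule.inner_left_of_mem_orthogonal hw (Submodule.sub_starProjection_mem_orthogonal (v i))
  have hWdist : ∀ w ∈ W, c ≤ ‖v i - w‖ := by
    intro w hw
    obtain ⟨l, hl, rfl⟩ := (Finsupp.mem_span_image_iff_linearCombination ℂ).1 hw
    have hi : i ∉ l.support := fun hi => hl hi rfl
    -- Minimality is applied to `v i - w`: coefficient 1 at i, and minus those of `w` elsewhere.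
    have := h (insert i l.support) (fun j => if j = i then 1 else -l j) i
      (Finset.mem_insert_self _ _)
    rw [Finset.sum_insert hi] at this
    simp only [if_true, norm_one, mul_one, one_smul] at this
    rw [Finsupp.linearCombination_apply, Finsupp.sum, sub_eq_add_neg, ← Finset.sum_neg_distrib]
    refine this.trans_eq ?_
    congr 2
    refine Finset.sum_congr rfl fun j hj => ?_
    rw [if_neg (fun h' : j = i => hi (h' ▸ hj)), neg_smul]
  have hMdist : ∀ w ∈ M, c ≤ ‖v i - w‖ := fun w hw =>
    closure_minimal (s := (W : Set H)) (t := {w | c ≤ ‖v i - w‖}) hWdist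
      (isClosed_le continuous_const (by fun_prop)) hw
  have hp : c ≤ ‖p‖ := hMdist _ (Submodule.starProjection_apply_mem _ _)
  have hp0 : 0 < ‖p‖ := hc.trans_le hp
  have hpp : inner ℂ p (v i) = (‖p‖ : ℂ) ^ 2 := by
    refine Eq.trans ?_ (inner_self_eq_norm_sq_to_K (𝕜 := ℂ) p)
    conv_rhs => rw [show inner ℂ p p = inner ℂ p (v i - M.starProjection (v i)) from rfl]
    rw [inner_sub_right, hpM _ (Submodule.starProjection_apply_mem _ _), sub_zero]
  have hpC : (‖p‖ : ℂ) ≠ 0 := by exact_mod_cast hp0.ne'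
  refine ⟨((‖p‖ ^ 2 : ℝ) : ℂ)⁻¹ • p, ?_, ?_, fun j hj => ?_, ?_⟩
  · refine Submodule.smul_mem _ _ (Submodule.sub_mem _ ?_
      (hWle (Submodule.starProjection_apply_mem _ _)))
    exact Submodule.le_topologicalClosure _ (Submodule.subset_span ⟨i, rfl⟩)
  · rw [inner_smul_left, hpp, map_inv₀, Complex.conj_ofReal]
    push_cast
    field_simp
  · rw [inner_smul_left, hpM _ (Submodule.le_topologicalClosure _
      (Submodule.subset_span ⟨j, hj, rfl⟩)), mul_zero]
  · rw [norm_smul, norm_inv, Complex.norm_real, Real.norm_of_nonneg (by positivity)]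
    calc _ = 1 / ‖p‖ := by field_simp
      _ ≤ 1 / c := by gcongr

theorem expTime_ae (α T : ℝ) (k : ℤ) : expTime α T k =ᵐ[volume.restrict (Set.Icc 0 T)]
    fun t => Complex.exp (Complex.I * eigenvalue α k * t) := MemLp.coeFn_toLp _

theorem expTime_congr {α T : ℝ} {j k : ℤ} (h : eigenvalue α j = eigenvalue α k) :
    expTime α T j = expTime α T k := by
  refine Lp.ext ((expTime_ae α T j).trans ?_)
  rw [h]
  exact (expTime_ae α T k).symm

theorem integral_Icc_eq_interval {E : Type*} [NormedAddCommGroup E] [NormedSpace ℝ E] {T : ℝ}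
    (hT : 0 ≤ T) (f : ℝ → E) : ∫ t in Set.Icc 0 T, f t = ∫ t in (0 : ℝ)..T, f t := by
  rw [intervalIntegral.integral_of_le hT, integral_Icc_eq_integral_Ioc]

theorem inner_expTime {α T : ℝ} (hT : 0 ≤ T) (q : L2Time T) (k : ℤ) :
    inner ℂ q (expTime α T k)
      = ∫ t in (0 : ℝ)..T, Complex.exp (Complex.I * eigenvalue α k * t) * conj (q t) := by
  rw [L2.inner_def, ← integral_Icc_eq_interval hT]
  refine integral_congr_ae ?_
  filter_upwards [expTime_ae α T k] with t ht
  rw [ht]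
  rfl

theorem norm_sq_L2Time {T : ℝ} (hT : 0 ≤ T) (f : L2Time T) (F : ℝ → ℂ)
    (h : f =ᵐ[volume.restrict (Set.Icc 0 T)] F) :
    ‖f‖ ^ 2 = ∫ t in (0 : ℝ)..T, ‖F t‖ ^ 2 := by
  rw [← integral_Icc_eq_interval hT]
  have h1 : ((‖f‖ ^ 2 : ℝ) : ℂ) = ((∫ t in Set.Icc 0 T, ‖F t‖ ^ 2 : ℝ) : ℂ) := by
    rw [Complex.ofReal_pow]
    refine (inner_self_eq_norm_sq_to_K (𝕜 := ℂ) f).symm.trans ?_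
    rw [L2.inner_def, ← integral_complex_ofReal]
    refine integral_congr_ae ?_
    filter_upwards [h] with t ht
    rw [ht, inner_self_eq_norm_sq_to_K, Complex.ofReal_pow]
    rfl
  exact_mod_cast h1

/-- The difference of two candidates lies in the closed span and is orthogonal to every exponential,
hence to itself. -/
theorem IsDualFamily.unique {α T : ℝ} (hT : 0 ≤ T) {q q' : ℤ → L2Time T}
    (hq : IsDualFamily α T q) (hq' : IsDualFamily α T q') : q' = q := by
  funext j
  set V := Submodule.span ℂ (Set.range (expTime α T))
  set d := q' j - q j
  have hd : d ∈ V.topologicalClosure := Submodule.sub_mem _ (hq'.1 j) (hq.1 j)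
  have horth : ∀ k, inner ℂ d (expTime α T k) = 0 := fun k => by
    rw [inner_sub_left, inner_expTime hT, inner_expTime hT]
    by_cases h : eigenvalue α j = eigenvalue α k
    · rw [(hq.2 j k).1 h, (hq'.2 j k).1 h, sub_self]
    · rw [(hq.2 j k).2 h, (hq'.2 j k).2 h, sub_self]
  have hV : V ≤ LinearMap.ker (innerSL ℂ d).toLinearMap := by
    rw [Submodule.span_le]
    rintro _ ⟨k, rfl⟩
    exact horth k
  have hcl : V.topologicalClosure ≤ LinearMap.ker (innerSL ℂ d).toLinearMap :=
    Submodule.topologicalClosure_minimal _ hV (innerSL ℂ d).isClosed_ker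
  have h0 : inner ℂ d d = 0 := hcl hd
  exact sub_eq_zero.1 (inner_self_eq_zero.1 h0)

theorem exists_dualFamily {α T : ℝ} (hα : 0 < α) (hT : 0 < T) :
    ∃ (q : ℤ → L2Time T) (B : ℝ), IsDualFamily α T q ∧ ∀ j, ‖q j‖ ≤ B := by
  classical
  obtain ⟨c, _, hc, _, H⟩ := riesz_eigenvalue hα hT
  -- Indexing by distinct eigenvalues is needed: different k may share one exponential, and the
  -- family over ℤ need not be minimal.
  let v : Set.range (eigenvalue α) → L2Time T := fun l => expTime α T l.2.choose
  have hv (k : ℤ) : v ⟨eigenvalue α k, k, rfl⟩ = expTime α T k :=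
    expTime_congr (Set.mem_range.1 (⟨k, rfl⟩ : eigenvalue α k ∈ Set.range _)).choose_spec
  have hvae (l : Set.range (eigenvalue α)) : v l =ᵐ[volume.restrict (Set.Icc 0 T)]
      fun t => Complex.exp (Complex.I * (l : ℝ) * t) := by
    have := expTime_ae α T l.2.choose
    rwa [l.2.choose_spec] at this
  have hrange : Set.range v = Set.range (expTime α T) := by
    ext f
    constructor
    · rintro ⟨l, rfl⟩
      exact ⟨_, rfl⟩
    · rintro ⟨k, rfl⟩
      exact ⟨_, hv k⟩
  have hbound : ∀ (S : Finset (Set.range (eigenvalue α))) (a : Set.range (eigenvalue α) → ℂ),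
      ∀ i ∈ S, √c * ‖a i‖ ≤ ‖∑ i ∈ S, a i • v i‖ := by
    intro S a i hi
    let a' : ℝ → ℂ := fun l => if h : l ∈ Set.range (eigenvalue α) then a ⟨l, h⟩ else 0
    have ha' (l : Set.range (eigenvalue α)) : a' l = a l := dif_pos l.2
    let S' : Finset ℝ := S.map (Function.Embedding.subtype _)
    have h1 := (H S' (fun l hl => by
      obtain ⟨m, -, rfl⟩ := Finset.mem_map.1 hl
      exact m.2) a').1
    rw [Finset.sum_map] at h1
    simp only [Function.Embedding.subtype_apply, ha'] at h1
    have h2 : ((∑ i ∈ S, a i • v i : L2Time T) : ℝ → ℂ)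
        =ᵐ[volume.restrict (Set.Icc 0 T)] expSum S' a' := by
      have hall : ∀ᵐ t ∂volume.restrict (Set.Icc 0 T), ∀ l ∈ S,
          (a l • v l : L2Time T) t = a l * Complex.exp (Complex.I * (l : ℝ) * t) := by
        rw [eventually_all_finset]
        intro l _
        filter_upwards [Lp.coeFn_smul (a l) (v l), hvae l] with t h3 h4
        rw [h3, Pi.smul_apply, h4, smul_eq_mul]
      filter_upwards [Lp.coeFn_finsetSum S (fun l => a l • v l), hall] with t h3 h4
      rw [h3, Finset.sum_apply, expSum, Finset.sum_map]
      refine Finset.sum_congr rfl fun l hl => ?_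
      rw [h4 l hl, Function.Embedding.subtype_apply, ha']
    rw [← norm_sq_L2Time hT.le _ _ h2] at h1
    have h3 : c * ‖a i‖ ^ 2 ≤ ‖∑ i ∈ S, a i • v i‖ ^ 2 := by
      refine le_trans ?_ h1
      gcongr
      exact Finset.single_le_sum (f := fun i => ‖a i‖ ^ 2) (fun _ _ => by positivity) hi
    refine le_of_sq_le_sq ?_ (norm_nonneg _)
    rwa [mul_pow, Real.sq_sqrt hc.le]
  choose Q hQ1 hQ2 hQ3 hQ4 using exists_biorthogonal v (Real.sqrt_pos.2 hc) hbound
  refine ⟨fun j => Q ⟨eigenvalue α j, j, rfl⟩, 1 / √c, ⟨fun j => ?_, fun j k => ⟨fun h => ?_,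
    fun h => ?_⟩⟩, fun j => hQ4 _⟩
  · rw [← hrange]
    exact hQ1 _
  · rw [← inner_expTime hT.le, ← expTime_congr h, ← hv]
    exact hQ2 _
  · rw [← inner_expTime hT.le, ← hv]
    exact hQ3 _ _ fun h' => h (congrArg Subtype.val h').symm

/-! ### The control operator in Fourier modes -/

/-- The Fourier coefficients of the real function `g`. -/
def gCoeff (g : Torus → ℝ) (n : ℤ) : ℂ := fourierCoeff (fun x => (g x : ℂ)) n

/-- The matrix of the control operator with respect to the exponentials `e^{ikx}`. -/
def controlMatrix (g : Torus → ℝ) (k j : ℤ) : ℂ :=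
  gCoeff g (k - j) - 2 * π * gCoeff g (-j) * gCoeff g k

theorem gCoeff_zero {g : Torus → ℝ} (hg : IsControlProfile g) : 2 * π * gCoeff g 0 = 1 := by
  have h1 : gCoeff g 0 = ((2 * π)⁻¹ : ℝ) • ∫ y : Torus, (g y : ℂ) := by
    rw [gCoeff, fourierCoeff, AddCircle.integral_haarAddCircle]
    simp
  have hpi : (π : ℂ) ≠ 0 := by exact_mod_cast Real.pi_ne_zero
  rw [h1, integral_complex_ofReal, hg.integral_eq_one, Complex.real_smul]
  push_cast
  field_simp

/-- The normalisation `∫ g = 1` makes `G h` have mean zero. -/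
theorem controlMatrix_zero_left {g : Torus → ℝ} (hg : IsControlProfile g) (j : ℤ) :
    controlMatrix g 0 j = 0 := by
  rw [controlMatrix, zero_sub, mul_right_comm, gCoeff_zero hg, one_mul, sub_self]

/-- The diagonal entry is `ĝ(0) - 2π ĝ(-j) ĝ(j)` with `ĝ(0) = 1/(2π)`. Once both decaying factors
are at most `1/(4π)`, the correction is at most `1/(8π)`. -/
theorem le_norm_controlMatrix_diag {g : Torus → ℝ} (hg : IsControlProfile g) :
    ∃ N : ℕ, ∀ j : ℤ, (N : ℝ) < |(j : ℝ)| → 1 / (4 * π) ≤ ‖controlMatrix g j j‖ := by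
  obtain ⟨C, hC⟩ := coeff_decay hg.smooth 1
  obtain ⟨N, hN⟩ := exists_nat_ge (4 * π * C)
  have hpi := Real.pi_pos
  refine ⟨N, fun j hj => ?_⟩
  have hj0 : 0 < |(j : ℝ)| := (Nat.cast_nonneg N).trans_lt hj
  have hb : ∀ n : ℤ, |(n : ℝ)| = |(j : ℝ)| → ‖gCoeff g n‖ ≤ 1 / (4 * π) := by
    intro n hn
    have hn0 : n ≠ 0 := by
      rintro rfl
      rw [Int.cast_zero, abs_zero] at hn
      linarith
    have h1 : ‖gCoeff g n‖ * |(n : ℝ)| ^ 1 ≤ C := hC n hn0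
    rw [pow_one, hn] at h1
    rw [le_div_iff₀ (by positivity)]
    by_contra! hlt
    have h2 : |(j : ℝ)| < ‖gCoeff g n‖ * (4 * π) * |(j : ℝ)| := by nlinarith
    nlinarith
  have h0 : ‖gCoeff g 0‖ = 1 / (2 * π) := by
    have := congrArg norm (gCoeff_zero hg)
    rw [norm_mul, norm_mul, Complex.norm_real, Real.norm_of_nonneg hpi.le, norm_one,
      Complex.norm_two] at this
    field_simp
    linarith
  have h1 : ‖2 * (π : ℂ) * gCoeff g (-j) * gCoeff g j‖ ≤ 1 / (8 * π) := by
    rw [norm_mul, norm_mul, norm_mul, Complex.norm_real, Real.norm_of_nonneg hpi.le,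
      Complex.norm_two]
    calc _ ≤ 2 * π * (1 / (4 * π)) * (1 / (4 * π)) := by
          gcongr
          · exact hb _ (by simp)
          · exact hb _ rfl
      _ = _ := by field_simp; norm_num
  have h2 := norm_sub_norm_le (gCoeff g 0) (2 * π * gCoeff g (-j) * gCoeff g j)
  have h3 : 1 / (4 * π) ≤ 1 / (2 * π) - 1 / (8 * π) := by
    have : 1 / (2 * π) - 1 / (8 * π) = 3 / 8 * (1 / π) := by field_simp; norm_num
    rw [this, show 1 / (4 * π) = 1 / 4 * (1 / π) by field_simp]
    have : 0 < 1 / π := by positivity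
    linarith
  rw [controlMatrix, sub_self]
  linarith

theorem coeff_expMode (s : ℝ≥0) (j k : ℤ) :
    fourierCoeff (expMode s j) k = if k = j then 1 else 0 := by
  rw [toL2_expMode, ← fourierBasis_repr, ← coe_fourierBasis, HilbertBasis.repr_self,
    lp.single_apply, Pi.single_apply]

theorem coeff_mulOp_expMode (s : ℝ≥0) {g : Torus → ℝ} (hg : SmoothTorus g) (j k : ℤ) :
    fourierCoeff (mulOp s hg (expMode s j)) k = gCoeff g (k - j) := by
  rw [fourierCoeff_congr_ae (mulOp_ae hg (expMode s j)), gCoeff]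
  refine (coeff_mul hg (expMode s j) k).unique ?_
  have := hasSum_single (f := fun m => fourierCoeff (fun x => (g x : ℂ)) m *
    fourierCoeff (expMode s j) (k - m)) (k - j) fun m hm => by
      rw [coeff_expMode, if_neg (fun h => hm (by omega)), mul_zero]
  simpa only [coeff_expMode, sub_sub_cancel, if_true, mul_one] using this

theorem coeff_controlOp_psi (s : ℝ≥0) {g : Torus → ℝ} (hg : SmoothTorus g) (j k : ℤ) :
    coeffCLM s k (controlOp s hg (psi s j))
      = ((√(2 * π) : ℝ) : ℂ)⁻¹ * controlMatrix g k j := by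
  have h (i : ℤ) : coeffCLM s k (mulOp s hg (expMode s i)) = gCoeff g (k - i) :=
    coeff_mulOp_expMode s hg i k
  have hp : pairing s hg (expMode s j) = 2 * π * gCoeff g (-j) := by
    show (2 * π : ℂ) * coeffCLM s 0 (mulOp s hg (expMode s j)) = _
    rw [coeffCLM_apply, coeff_mulOp_expMode, zero_sub]
  rw [psi, map_smul, map_smul, smul_eq_mul]
  congr 1
  show coeffCLM s k (mulOp s hg (expMode s j - pairing s hg (expMode s j) • expMode s 0)) = _
  rw [map_sub, map_sub, map_smul, map_smul, h, h, hp, sub_zero, smul_eq_mul, controlMatrix]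

theorem fourier_two_pi_apply (n : ℤ) (x : ℝ) :
    fourier n (x : Torus) = Complex.exp (Complex.I * (n : ℝ) * x) := by
  rw [fourier_coe_apply]
  congr 1
  have hpi : (π : ℂ) ≠ 0 := by exact_mod_cast Real.pi_ne_zero
  push_cast
  field_simp

/-- A trigonometric polynomial vanishing on an interval has vanishing coefficients. -/
theorem coeff_eq_zero_of_vanish (F : Finset ℤ) (b : ℤ → ℂ) {u v : ℝ} (huv : u < v)
    (h : ∀ x ∈ Set.Ioo u v, ∑ j ∈ F, b j * fourier j (x : Torus) = 0) :
    ∀ j ∈ F, b j = 0 := by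
  classical
  let F' : Finset ℝ := F.map ⟨fun j : ℤ => (j : ℝ), Int.cast_injective⟩
  -- The floor recovers the integer frequency, and the unimodular factor translates the interval so
  -- that it starts at 0, where the Riesz bound applies.
  let b' : ℝ → ℂ := fun l => b ⌊l⌋ * Complex.exp (Complex.I * l * u)
  obtain ⟨c, _, hc, _, H⟩ := riesz_finset F' (sub_pos.2 huv)
  have h1 := (H F' subset_rfl b').1
  have h2 : ∫ t in (0 : ℝ)..v - u, ‖expSum F' b' t‖ ^ 2 = 0 := by
    rw [intervalIntegral.integral_of_le (sub_pos.2 huv).le, integral_Ioc_eq_integral_Ioo]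
    refine setIntegral_eq_zero_of_forall_eq_zero fun t ht => ?_
    have h3 : expSum F' b' t = ∑ j ∈ F, b j * fourier j ((u + t : ℝ) : Torus) := by
      rw [expSum, Finset.sum_map]
      refine Finset.sum_congr rfl fun j _ => ?_
      simp only [b', Function.Embedding.coeFn_mk, Int.floor_intCast]
      rw [fourier_two_pi_apply, mul_assoc, ← Complex.exp_add]
      congr 2
      push_cast; ring
    rw [h3, h _ ⟨by linarith [ht.1], by linarith [ht.2]⟩]
    simp
  rw [h2, Finset.sum_map] at h1
  intro j hj
  have h3 : ∑ j ∈ F, ‖b' (j : ℝ)‖ ^ 2 ≤ 0 := by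
    by_contra! hlt
    exact absurd h1 (not_le.2 (mul_pos hc hlt))
  have h4 := (Finset.sum_eq_zero_iff_of_nonneg fun i _ => by positivity).1
    (le_antisymm h3 (Finset.sum_nonneg fun _ _ => by positivity)) j hj
  simpa [b'] using h4

theorem coeff_mul_trigPoly {g : Torus → ℝ} (hg : Continuous g) (F : Finset ℤ) (b : ℤ → ℂ)
    (k : ℤ) :
    fourierCoeff (fun x : Torus => (g x : ℂ) * ∑ j ∈ F, b j * fourier j x) k
      = ∑ j ∈ F, b j * gCoeff g (k - j) := by
  have hcont : Continuous fun x => (g x : ℂ) := Complex.continuous_ofReal.comp hg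
  simp only [gCoeff, fourierCoeff, smul_eq_mul]
  simp only [← integral_const_mul]
  rw [← integral_finsetSum]
  · refine integral_congr_ae (Eventually.of_forall fun x => ?_)
    simp only [Finset.mul_sum]
    refine Finset.sum_congr rfl fun j _ => ?_
    rw [show -(k - j) = -k + j by ring, fourier_add]
    ring
  · intro j _
    exact Continuous.integrable_of_hasCompactSupport (by fun_prop)
      (HasCompactSupport.of_compactSpace _)

/-- The Toeplitz form is `∫ g |p|²` for the trigonometric polynomial `p` with coefficients `b`. If
it vanishes, continuity gives `g |p|² = 0` everywhere, so `p` vanishes on the arc `{g > 0}`. -/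
theorem toeplitz_definite {g : Torus → ℝ} (hg : IsControlProfile g) (F : Finset ℤ) (b : ℤ → ℂ)
    (h : ∀ k ∈ F, ∑ j ∈ F, b j * gCoeff g (k - j) = 0) : ∀ j ∈ F, b j = 0 := by
  have hgc : Continuous g := hg.smooth.continuous
  have hcont : Continuous fun x => (g x : ℂ) := Complex.continuous_ofReal.comp hgc
  set p : Torus → ℂ := fun x => ∑ j ∈ F, b j * fourier j x with hp
  have hpc : Continuous p := by rw [hp]; fun_prop
  have h1 : ∫ x : Torus, conj (p x) * (g x * p x) ∂AddCircle.haarAddCircle = 0 := by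
    have e (x : Torus) : conj (p x) * (g x * p x)
        = ∑ k ∈ F, conj (b k) * (fourier (-k) x • (g x * p x)) := by
      rw [hp, map_sum, Finset.sum_mul]
      refine Finset.sum_congr rfl fun k _ => ?_
      rw [map_mul, fourier_neg, smul_eq_mul]; ring
    simp only [e]
    rw [integral_finsetSum]
    · refine Finset.sum_eq_zero fun k hk => ?_
      rw [integral_const_mul]
      have := coeff_mul_trigPoly hgc F b k
      rw [h k hk, fourierCoeff] at this
      rw [hp, this, mul_zero]
    · intro k _
      exact Continuous.integrable_of_hasCompactSupport (by fun_prop)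
        (HasCompactSupport.of_compactSpace _)
  have h2 : ∫ x : Torus, g x * ‖p x‖ ^ 2 ∂AddCircle.haarAddCircle = 0 := by
    have e (x : Torus) : conj (p x) * (g x * p x) = ((g x * ‖p x‖ ^ 2 : ℝ) : ℂ) := by
      rw [mul_left_comm, Complex.conj_mul']
      push_cast
      rfl
    simp only [e] at h1
    rw [integral_complex_ofReal] at h1
    exact_mod_cast h1
  have hc2 : Continuous fun x => g x * ‖p x‖ ^ 2 := by fun_prop
  have h3 : (fun x => g x * ‖p x‖ ^ 2) = 0 := by
    refine (Continuous.ae_eq_iff_eq (AddCircle.haarAddCircle : Measure Torus) hc2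
      continuous_zero).1 ?_
    exact (integral_eq_zero_iff_of_nonneg
      (fun x => mul_nonneg (hg.nonneg x) (by positivity))
      (Continuous.integrable_of_hasCompactSupport hc2
        (HasCompactSupport.of_compactSpace _))).1 h2
  obtain ⟨u, v, huv, harc⟩ := hg.arc
  refine coeff_eq_zero_of_vanish F b huv fun x hx => ?_
  have h4 : 0 < g (x : Torus) := by
    have : (x : Torus) ∈ {x : Torus | 0 < g x} := by rw [harc]; exact ⟨x, hx, rfl⟩
    exact this
  have h5 : g (x : Torus) * ‖p (x : Torus)‖ ^ 2 = 0 := congrFun h3 _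
  have h6 := (mul_eq_zero.1 h5).resolve_left h4.ne'
  exact norm_eq_zero.1 (pow_eq_zero_iff two_ne_zero |>.1 h6)

/-- Principal submatrices of the control matrix without the index `0` are nonsingular. -/
theorem controlMatrix_injective {g : Torus → ℝ} (hg : IsControlProfile g) (F : Finset ℤ)
    (h0 : (0 : ℤ) ∉ F) (a : ℤ → ℂ) (h : ∀ k ∈ F, ∑ j ∈ F, a j * controlMatrix g k j = 0) :
    ∀ j ∈ F, a j = 0 := by
  classical
  set c := 2 * π * ∑ j ∈ F, a j * gCoeff g (-j)
  -- The constant `∫ g h` subtracted by `G` becomes an extra coefficient at frequency 0, so the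
  -- rank-one term of the matrix is absorbed and a pure Toeplitz system remains. Its row 0 holds
  -- automatically.
  let b : ℤ → ℂ := fun j => if j = 0 then -c else a j
  have hb : ∀ j ∈ F, b j = a j := fun j hj => if_neg fun h' : j = 0 => h0 (h' ▸ hj)
  have hsum (k : ℤ) : ∑ j ∈ insert 0 F, b j * gCoeff g (k - j)
      = ∑ j ∈ F, a j * controlMatrix g k j := by
    rw [Finset.sum_insert h0, Finset.sum_congr rfl fun j hj => by rw [hb j hj]]
    simp only [b, if_true, sub_zero, controlMatrix, mul_sub, Finset.sum_sub_distrib]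
    rw [neg_mul, neg_add_eq_sub]
    congr 1
    simp only [c]
    rw [Finset.mul_sum, Finset.sum_mul]
    exact Finset.sum_congr rfl fun j _ => by ring
  have := toeplitz_definite hg (insert 0 F) b fun k hk => by
    rw [hsum]
    rcases Finset.mem_insert.1 hk with rfl | hk
    · exact Finset.sum_eq_zero fun j _ => by rw [controlMatrix_zero_left hg, mul_zero]
    · exact h k hk
  intro j hj
  rw [← hb j hj]
  exact this j (Finset.mem_insert_of_mem hj)

/-! ### Convergence and norms of the control series -/

theorem norm_sq_Lp_two {X E : Type*} [MeasurableSpace X] {μ : Measure X} [NormedAddCommGroup E]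
    (f : Lp E 2 μ) : ‖f‖ ^ 2 = ∫ x, ‖f x‖ ^ 2 ∂μ := by
  have h := (Lp.memLp f).eLpNorm_eq_integral_rpow_norm (by norm_num) (by norm_num)
  have h0 : 0 ≤ ∫ x, ‖f x‖ ^ 2 ∂μ := integral_nonneg fun _ => by positivity
  rw [Lp.norm_def, h, ENNReal.toReal_ofReal (by positivity)]
  simp only [ENNReal.toReal_ofNat, Real.rpow_ofNat]
  rw [← Real.rpow_natCast, ← Real.rpow_mul h0]
  norm_num

/-- A series whose finite partial sums are bounded in square by a summable series. -/
theorem exists_hasSum_of_norm_sq_le {E ι : Type*} [NormedAddCommGroup E] [CompleteSpace E]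
    {f : ι → E} {φ : ι → ℝ} {x : ℝ} (hφ : HasSum φ x) (hφ0 : ∀ i, 0 ≤ φ i)
    (h : ∀ A : Finset ι, ‖∑ i ∈ A, f i‖ ^ 2 ≤ ∑ i ∈ A, φ i) :
    ∃ y, HasSum f y ∧ ‖y‖ ^ 2 ≤ x := by
  have hf : Summable f := by
    rw [summable_iff_vanishing_norm]
    intro ε hε
    obtain ⟨S, hS⟩ := summable_iff_vanishing_norm.1 hφ.summable (ε ^ 2) (by positivity)
    refine ⟨S, fun A hA => ?_⟩
    refine lt_of_pow_lt_pow_left₀ 2 hε.le ((h A).trans_lt ?_)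
    exact (le_abs_self _).trans_lt (hS A hA)
  refine ⟨_, hf.hasSum, ?_⟩
  have ht : Tendsto (fun A : Finset ι => ‖∑ i ∈ A, f i‖ ^ 2) atTop (𝓝 (‖∑' i, f i‖ ^ 2)) :=
    (hf.hasSum.norm).pow 2
  exact le_of_tendsto ht (Eventually.of_forall fun A =>
    (h A).trans (sum_le_hasSum A (fun i _ => hφ0 i) hφ))

theorem coeff_psi (s : ℝ≥0) (j k : ℤ) :
    fourierCoeff (psi s j) k = ((√(2 * π) : ℝ) : ℂ)⁻¹ * if k = j then 1 else 0 := by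
  rw [psi, coeff_smul, coeff_expMode]

theorem norm_sq_sum_psi (s : ℝ≥0) (A : Finset ℤ) (a : ℤ → ℂ) :
    ‖∑ j ∈ A, a j • psi s j‖ ^ 2
      = ∑ j ∈ A, ‖(weight s j : ℂ) * (((√(2 * π) : ℝ) : ℂ)⁻¹ * a j)‖ ^ 2 := by
  have hc (k : ℤ) : fourierCoeff (∑ j ∈ A, a j • psi s j : Sobolev s) k
      = if k ∈ A then ((√(2 * π) : ℝ) : ℂ)⁻¹ * a k else 0 := by
    rw [← coeffCLM_apply, map_sum]
    simp only [map_smul, coeffCLM_apply, coeff_psi, smul_eq_mul]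
    simp only [mul_ite, mul_one, mul_zero, Finset.sum_ite_eq]
    congr 1
    ring
  refine (norm_sq_hasSum _).unique ?_
  simp only [hc]
  have : HasSum (fun k => ‖(weight s k : ℂ) *
      if k ∈ A then ((√(2 * π) : ℝ) : ℂ)⁻¹ * a k else 0‖ ^ 2) _ :=
    hasSum_sum_of_ne_finset_zero (s := A) fun k hk => by
      rw [if_neg hk]; simp
  rwa [Finset.sum_congr rfl fun k hk => by rw [if_pos hk]] at this

/-- Orthogonality of the `ψⱼ` in `H^s` at each time decouples the modes, so no relation between
different `qⱼ` enters, only their norms. -/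
theorem norm_sq_sum_tensorPsi (s : ℝ≥0) {T : ℝ} (q : ℤ → L2Time T) (A : Finset ℤ) (c : ℤ → ℂ) :
    ‖∑ j ∈ A, c j • tensorPsi s (q j) j‖ ^ 2
      = ∑ j ∈ A, ‖(weight s j : ℂ) * (((√(2 * π) : ℝ) : ℂ)⁻¹ * c j)‖ ^ 2 * ‖q j‖ ^ 2 := by
  have h1 : ((∑ j ∈ A, c j • tensorPsi s (q j) j : L2TimeSobolev s T) : ℝ → Sobolev s)
      =ᵐ[volume.restrict (Set.Icc 0 T)] fun t => ∑ j ∈ A, (c j * conj (q j t)) • psi s j := by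
    have hall : ∀ᵐ t ∂volume.restrict (Set.Icc 0 T), ∀ j ∈ A,
        (c j • tensorPsi s (q j) j : L2TimeSobolev s T) t = (c j * conj (q j t)) • psi s j := by
      rw [eventually_all_finset]
      intro j _
      filter_upwards [Lp.coeFn_smul (c j) (tensorPsi s (q j) j), tensorPsi_ae (s := s) (q j) j]
        with t h3 h4
      rw [h3, Pi.smul_apply, h4, smul_smul]
    filter_upwards [Lp.coeFn_finsetSum A (fun j => c j • tensorPsi s (q j) j), hall] with t h3 h4
    rw [h3, Finset.sum_apply]
    exact Finset.sum_congr rfl h4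
  rw [norm_sq_Lp_two]
  have h2 : ∫ t in Set.Icc 0 T, ‖(∑ j ∈ A, c j • tensorPsi s (q j) j : L2TimeSobolev s T) t‖ ^ 2
      = ∫ t in Set.Icc 0 T, ∑ j ∈ A,
        ‖(weight s j : ℂ) * (((√(2 * π) : ℝ) : ℂ)⁻¹ * c j)‖ ^ 2 * ‖q j t‖ ^ 2 := by
    refine integral_congr_ae ?_
    filter_upwards [h1] with t ht
    rw [ht, norm_sq_sum_psi]
    refine Finset.sum_congr rfl fun j _ => ?_
    simp only [norm_mul, RCLike.norm_conj]
    ring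
  rw [h2, integral_finsetSum]
  · refine Finset.sum_congr rfl fun j _ => ?_
    rw [integral_const_mul, norm_sq_Lp_two]
  · intro j _
    exact ((memLp_two_iff_integrable_sq_norm (Lp.aestronglyMeasurable _)).1
      (Lp.memLp (q j))).const_mul _

/-- Bounded diagonal operators from `H^s_p(𝕋)` into series `∑ⱼ hⱼ conj(qⱼ(t)) ψⱼ(x)`. -/
theorem exists_synthesis (s : ℝ≥0) {T B M : ℝ} {q : ℤ → L2Time T} (hq : ∀ j, ‖q j‖ ≤ B)
    {b : ℤ → ℂ} (hb : ∀ j, ‖b j‖ ≤ M) :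
    ∃ Λ : Sobolev s →L[ℂ] L2TimeSobolev s T,
      ∀ d : Sobolev s, HasSum (fun j => (b j * fourierCoeff d j) • tensorPsi s (q j) j) (Λ d) := by
  have hB : 0 ≤ B := (norm_nonneg _).trans (hq 0)
  have hM : 0 ≤ M := (norm_nonneg _).trans (hb 0)
  have h2 : 0 < √(2 * π) := Real.sqrt_pos.2 Real.two_pi_pos
  have key (d : Sobolev s) : ∃ y : L2TimeSobolev s T,
      HasSum (fun j => (b j * fourierCoeff d j) • tensorPsi s (q j) j) y ∧
        ‖y‖ ^ 2 ≤ ((√(2 * π))⁻¹ * M * B) ^ 2 * ‖d‖ ^ 2 := by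
    refine exists_hasSum_of_norm_sq_le ((norm_sq_hasSum d).mul_left _)
      (fun _ => by positivity) fun A => ?_
    rw [norm_sq_sum_tensorPsi]
    refine Finset.sum_le_sum fun j _ => ?_
    rw [← mul_pow, ← mul_pow]
    refine pow_le_pow_left₀ (by positivity) ?_ 2
    simp only [norm_mul, norm_inv, Complex.norm_real, Real.norm_of_nonneg h2.le]
    have h3 := hq j
    have h4 := hb j
    calc ‖weight s j‖ * ((√(2 * π))⁻¹ * (‖b j‖ * ‖fourierCoeff d j‖)) * ‖q j‖
        ≤ ‖weight s j‖ * ((√(2 * π))⁻¹ * (M * ‖fourierCoeff d j‖)) * B := by gcongr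
      _ = _ := by ring
  choose Λ hΛ hΛn using key
  refine ⟨LinearMap.mkContinuous
    { toFun := Λ
      map_add' := fun d e => (hΛ _).unique ?_
      map_smul' := fun c d => (hΛ _).unique ?_ } ((√(2 * π))⁻¹ * M * B) fun d => ?_, hΛ⟩
  · refine ((hΛ d).add (hΛ e)).congr_fun fun j => ?_
    rw [coeff_add, mul_add, add_smul]
  · refine ((hΛ d).const_smul c).congr_fun fun j => ?_
    rw [coeff_smul, smul_smul, mul_left_comm]
  · refine le_of_sq_le_sq ?_ (by positivity)
    rw [mul_pow]
    exact hΛn d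

/-! ### Reduction of the control problem to moments -/

theorem symbol_eq_exp (α t : ℝ) (k : ℤ) :
    symbol α t k = Complex.exp (-(Complex.I * eigenvalue α k * t)) := by
  have h : (k.sign : ℝ) * |(k : ℝ)| = k := by exact_mod_cast Int.sign_mul_abs k
  have h2 : (k : ℝ) ^ 2 * (k.sign : ℝ) = k * |(k : ℝ)| := by
    rw [← sq_abs]
    linear_combination |(k : ℝ)| * h
  have h3 : (k : ℝ) ^ 2 * (α * (k.sign : ℝ) - (k : ℝ)) * t = -(eigenvalue α k * t) := by
    rw [eigenvalue]
    linear_combination α * t * h2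
  rw [symbol, h3]
  congr 1
  push_cast; ring

theorem symbol_add (α t t' : ℝ) (k : ℤ) : symbol α (t + t') k = symbol α t k * symbol α t' k := by
  simp only [symbol_eq_exp]
  rw [← Complex.exp_add]
  congr 1
  push_cast; ring

theorem symbol_neg_mul (α t : ℝ) (k : ℤ) : symbol α (-t) k * symbol α t k = 1 := by
  rw [← symbol_add, neg_add_cancel, symbol_eq_exp]
  simp

theorem continuous_symbol (α : ℝ) (k : ℤ) : Continuous fun t => symbol α t k := by
  unfold symbol; fun_prop

/-- Strong continuity: the squared distance is a series of continuous functions dominated by `4‖f‖²`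
term by term. Together with the isometry property it gives joint continuity, and hence measurability
of the Duhamel integrand. -/
theorem continuous_evolution (s : ℝ≥0) (α : ℝ) (f : Sobolev s) :
    Continuous fun t => evolution s α t f := by
  rw [continuous_iff_continuousAt]
  intro t₀
  have hsq (t : ℝ) : ‖evolution s α t f - evolution s α t₀ f‖ ^ 2
      = ∑' k, ‖(weight s k : ℂ) * ((symbol α t k - symbol α t₀ k) * fourierCoeff f k)‖ ^ 2 := by
    rw [← (norm_sq_hasSum _).tsum_eq]
    refine tsum_congr fun k => ?_
    rw [← coeffCLM_apply k (evolution s α t f - _), map_sub, coeffCLM_apply, coeffCLM_apply,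
      coeff_evolution, coeff_evolution, sub_mul]
  have hcont : Continuous fun t => ‖evolution s α t f - evolution s α t₀ f‖ ^ 2 := by
    simp only [hsq]
    refine continuous_tsum (u := fun k => 4 * ‖(weight s k : ℂ) * fourierCoeff f k‖ ^ 2)
      (fun k => ?_) ((weighted_summable f).mul_left 4) fun k t => ?_
    · have := continuous_symbol α k
      fun_prop
    · rw [Real.norm_of_nonneg (by positivity), mul_left_comm, norm_mul, mul_pow]
      gcongr
      have h1 := norm_sub_le (symbol α t k) (symbol α t₀ k)
      rw [norm_symbol, norm_symbol] at h1
      calc _ ≤ (1 + 1 : ℝ) ^ 2 := pow_le_pow_left₀ (norm_nonneg _) h1 2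
        _ = 4 := by norm_num
  have h1 : Tendsto (fun t => ‖evolution s α t f - evolution s α t₀ f‖) (𝓝 t₀) (𝓝 0) := by
    have := (hcont.tendsto t₀).sqrt
    simpa using this
  exact tendsto_iff_norm_sub_tendsto_zero.2 h1

theorem continuous_evolution_uncurry (s : ℝ≥0) (α : ℝ) :
    Continuous fun p : ℝ × Sobolev s => evolution s α p.1 p.2 :=
  continuous_prod_of_continuous_lipschitzWith' _ 1
    (fun t => (evolution s α t).isometry.lipschitz) (fun f => continuous_evolution s α f)

theorem aestronglyMeasurable_comp_sub {E : Type*} [TopologicalSpace E] {U : ℝ → E → E}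
    (hU : Continuous fun p : ℝ × E => U p.1 p.2) (T : ℝ) {μ : Measure ℝ} {f : ℝ → E}
    (hf : AEStronglyMeasurable f μ) : AEStronglyMeasurable (fun τ => U (T - τ) (f τ)) μ := by
  have h1 : AEStronglyMeasurable (fun τ : ℝ => T - τ) μ :=
    Continuous.aestronglyMeasurable (by fun_prop)
  exact hU.comp_aestronglyMeasurable (h1.prodMk hf)

theorem intervalIntegrable_evolution {g : Torus → ℝ} (hg : SmoothTorus g) (α : ℝ) {T : ℝ}
    (hT : 0 ≤ T) (h : L2TimeSobolev s T) :
    IntervalIntegrable (fun τ => evolution s α (T - τ) (controlOp s hg (h τ))) volume 0 T := by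
  rw [intervalIntegrable_iff_integrableOn_Icc_of_le hT, IntegrableOn]
  have h1 : Integrable (fun τ => controlOp s hg (h τ)) (volume.restrict (Set.Icc 0 T)) :=
    (controlOp s hg).integrable_comp ((Lp.memLp h).integrable (by norm_num))
  have h3 : AEStronglyMeasurable (fun τ => evolution s α (T - τ) (controlOp s hg (h τ)))
      (volume.restrict (Set.Icc 0 T)) :=
    aestronglyMeasurable_comp_sub (U := fun t f => evolution s α t f)
      (continuous_evolution_uncurry s α) T h1.aestronglyMeasurable
  refine h1.mono h3 (Eventually.of_forall fun τ => ?_)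
  exact ((evolution s α (T - τ)).norm_map (controlOp s hg (h τ))).le

/-- The functional `h ↦ ∫₀ᵀ e^{iλₖτ} (G h)^(k, τ) dτ`. -/
def momentCLM (s : ℝ≥0) {g : Torus → ℝ} (hg : SmoothTorus g) (α T : ℝ) (k : ℤ) :
    L2TimeSobolev s T →L[ℂ] ℂ :=
  -- The inner product conjugates its first argument; `star` undoes this, leaving `e^{iλₖτ}` in the
  -- integral.
  (innerSL ℂ (star (expTime α T k))).comp
    (((coeffCLM s k).comp (controlOp s hg)).compLpL 2 (volume.restrict (Set.Icc 0 T)))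

theorem momentCLM_apply {g : Torus → ℝ} (hg : SmoothTorus g) (α : ℝ) {T : ℝ} (hT : 0 ≤ T) (k : ℤ)
    (h : L2TimeSobolev s T) : momentCLM s hg α T k h = ∫ τ in (0 : ℝ)..T,
      Complex.exp (Complex.I * eigenvalue α k * τ) * coeffCLM s k (controlOp s hg (h τ)) := by
  show inner ℂ (star (expTime α T k)) (((coeffCLM s k).comp (controlOp s hg)).compLpL 2
    (volume.restrict (Set.Icc 0 T)) h) = _
  rw [L2.inner_def, ← integral_Icc_eq_interval hT]
  refine integral_congr_ae ?_
  filter_upwards [expTime_ae α T k, Lp.coeFn_star (expTime α T k),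
    ContinuousLinearMap.coeFn_compLpL ((coeffCLM s k).comp (controlOp s hg)) h] with t h1 h2 h3
  rw [h2, h3, Pi.star_apply, h1, RCLike.inner_apply', ContinuousLinearMap.comp_apply]
  congr 1
  exact Complex.conj_conj _

/-- The control problem is a moment problem. -/
theorem steers_iff {g : Torus → ℝ} (hg : SmoothTorus g) (α : ℝ) {T : ℝ} (hT : 0 ≤ T)
    (u₀ u₁ : Sobolev s) (h : L2TimeSobolev s T) :
    Steers hg α T u₀ u₁ h ↔
      ∀ k, momentCLM s hg α T k h = coeffCLM s k (evolution s α (-T) u₁ - u₀) := by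
  have hint := intervalIntegrable_evolution hg α hT h
  have hcoeff (k : ℤ) : coeffCLM s k (evolution s α T u₀
      + ∫ τ in (0 : ℝ)..T, evolution s α (T - τ) (controlOp s hg (h τ)))
      = symbol α T k * (coeffCLM s k u₀ + momentCLM s hg α T k h) := by
    rw [map_add, ← ContinuousLinearMap.intervalIntegral_comp_comm _ hint, mul_add,
      momentCLM_apply hg α hT, ← intervalIntegral.integral_const_mul]
    congr 1
    · exact coeff_evolution α T u₀ k
    · refine intervalIntegral.integral_congr fun τ _ => ?_
      show fourierCoeff (evolution s α (T - τ) (controlOp s hg (h τ))) k = _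
      -- The symbol of `U(T - τ)` factors as that of `U(T)` times `e^{iλₖτ}`, which is the moment
      -- kernel.
      rw [coeff_evolution, sub_eq_add_neg, symbol_add, mul_assoc]
      congr 2
      rw [symbol_eq_exp]
      congr 1
      push_cast; ring
  have hd (k : ℤ) : coeffCLM s k (evolution s α (-T) u₁ - u₀)
      = symbol α (-T) k * coeffCLM s k u₁ - coeffCLM s k u₀ := by
    rw [map_sub]
    congr 1
    exact coeff_evolution α (-T) u₁ k
  rw [Steers, and_iff_right hint]
  constructor
  · intro he k
    have h1 := hcoeff k
    rw [← he] at h1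
    rw [hd, h1, ← mul_assoc, symbol_neg_mul, one_mul, add_sub_cancel_left]
  · intro hm
    refine ext_coeff fun k => ?_
    show coeffCLM s k u₁ = coeffCLM s k _
    rw [hcoeff, hm, hd, add_sub_cancel, ← mul_assoc, mul_comm (symbol α T k), symbol_neg_mul,
      one_mul]

/-! ### Solving the moment problem -/

/-- The moments of the functions `conj(qⱼ(t)) ψⱼ(x)`. -/
def momentMatrix (α : ℝ) (g : Torus → ℝ) (k j : ℤ) : ℂ :=
  if eigenvalue α j = eigenvalue α k then ((√(2 * π) : ℝ) : ℂ)⁻¹ * controlMatrix g k j else 0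

theorem momentCLM_tensorPsi {g : Torus → ℝ} (hg : SmoothTorus g) {α T : ℝ} (hT : 0 ≤ T)
    {q : ℤ → L2Time T} (hq : IsDualFamily α T q) (k j : ℤ) :
    momentCLM s hg α T k (tensorPsi s (q j) j) = momentMatrix α g k j := by
  have h1 : momentCLM s hg α T k (tensorPsi s (q j) j)
      = (∫ t in (0 : ℝ)..T, Complex.exp (Complex.I * eigenvalue α k * t) * conj (q j t))
        * (((√(2 * π) : ℝ) : ℂ)⁻¹ * controlMatrix g k j) := by
    rw [momentCLM_apply hg α hT, ← intervalIntegral.integral_mul_const,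
      ← integral_Icc_eq_interval hT, ← integral_Icc_eq_interval hT]
    refine integral_congr_ae ?_
    filter_upwards [tensorPsi_ae (s := s) (q j) j] with t ht
    rw [ht, map_smul, map_smul, coeff_controlOp_psi, smul_eq_mul]
    ring
  rw [h1, momentMatrix]
  split_ifs with h
  · rw [(hq.2 j k).1 h, one_mul]
  · rw [(hq.2 j k).2 h, zero_mul]

theorem momentMatrix_zero_left {g : Torus → ℝ} (hg : IsControlProfile g) (α : ℝ) (j : ℤ) :
    momentMatrix α g 0 j = 0 := by
  rw [momentMatrix, controlMatrix_zero_left hg, mul_zero, ite_self]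

/-- Structure of the moment matrix: a nonsingular block with indices in a finite set `F`, and a
diagonal part that is bounded below. -/
theorem momentMatrix_structure {g : Torus → ℝ} (hg : IsControlProfile g) {α : ℝ} (hα : 0 < α) :
    ∃ (F : Finset ℤ) (M : ℝ), (0 : ℤ) ∉ F ∧
      (∀ a : ℤ → ℂ, (∀ k ∈ F, ∑ j ∈ F, a j * momentMatrix α g k j = 0) → ∀ j ∈ F, a j = 0) ∧
      (∀ k ∈ F, ∀ j ∉ F, j ≠ 0 → momentMatrix α g k j = 0) ∧
      (∀ k ∉ F, k ≠ 0 → momentMatrix α g k k ≠ 0 ∧ ‖(momentMatrix α g k k)⁻¹‖ ≤ M ∧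
        ∀ j ≠ k, momentMatrix α g k j = 0) := by
  classical
  obtain ⟨N₁, hN₁⟩ := exists_eigenvalue_simple hα
  obtain ⟨N₂, hN₂⟩ := le_norm_controlMatrix_diag hg
  -- Beyond `N₁` eigenvalues are simple and beyond `N₂` the diagonal is bounded below. Index 0 is
  -- removed, since row 0 of the matrix vanishes.
  set F := (finite_abs_le (max N₁ N₂)).toFinset.erase 0
  have hs2 : 0 < √(2 * π) := Real.sqrt_pos.2 Real.two_pi_pos
  have hsC : ((√(2 * π) : ℝ) : ℂ)⁻¹ ≠ 0 := inv_ne_zero (by exact_mod_cast hs2.ne')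
  have hlarge {k : ℤ} (hk : k ∉ F) (hk0 : k ≠ 0) : (N₁ : ℝ) < |(k : ℝ)| ∧ (N₂ : ℝ) < |(k : ℝ)| := by
    have h : ¬ |(k : ℝ)| ≤ max (N₁ : ℝ) N₂ := fun hle =>
      hk (Finset.mem_erase.2 ⟨hk0, by simpa using hle⟩)
    exact max_lt_iff.1 (not_le.1 h)
  refine ⟨F, √(2 * π) * (4 * π), Finset.notMem_erase _ _, fun a ha l hl => ?_,
    fun k hk j hj hj0 => ?_, fun k hk hk0 => ?_⟩
  · refine controlMatrix_injective hg (F.filter fun j => eigenvalue α j = eigenvalue α l)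
      (fun h => Finset.notMem_erase _ _ (Finset.mem_filter.1 h).1) a (fun k hk => ?_) l
      (Finset.mem_filter.2 ⟨hl, rfl⟩)
    obtain ⟨hkF, hkl⟩ := Finset.mem_filter.1 hk
    have h1 := ha k hkF
    simp only [momentMatrix, hkl, mul_ite, mul_zero] at h1
    rw [← Finset.sum_filter] at h1
    simp only [mul_left_comm (a _) (((√(2 * π) : ℝ) : ℂ)⁻¹)] at h1
    rw [← Finset.mul_sum] at h1
    exact (mul_eq_zero.1 h1).resolve_left hsC
  · refine if_neg fun h => hj ?_
    rw [← hN₁ j k (hlarge hj hj0).1 h.symm]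
    exact hk
  · have h1 : momentMatrix α g k k = ((√(2 * π) : ℝ) : ℂ)⁻¹ * controlMatrix g k k := if_pos rfl
    have h2 := hN₂ k (hlarge hk hk0).2
    have h3 : 0 < ‖controlMatrix g k k‖ := lt_of_lt_of_le (by positivity) h2
    refine ⟨?_, ?_, fun j hj => if_neg fun h => hj (hN₁ k j (hlarge hk hk0).1 h)⟩
    · rw [h1]
      exact mul_ne_zero hsC (norm_pos_iff.1 h3)
    · rw [h1, mul_inv, inv_inv, norm_mul, Complex.norm_real, Real.norm_of_nonneg hs2.le, norm_inv]
      gcongr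
      rw [inv_le_comm₀ h3 (by positivity)]
      simpa using h2

theorem hasSum_moments {g : Torus → ℝ} (hg : SmoothTorus g) {α T : ℝ} (hT : 0 ≤ T)
    {q : ℤ → L2Time T} (hq : IsDualFamily α T q) {c : ℤ → ℂ} {h : L2TimeSobolev s T}
    (hc : HasSum (fun j => c j • tensorPsi s (q j) j) h) (k : ℤ) :
    HasSum (fun j => c j * momentMatrix α g k j) (momentCLM s hg α T k h) := by
  refine ((momentCLM s hg α T k).hasSum hc).congr_fun fun j => ?_
  rw [map_smul, momentCLM_tensorPsi hg hT hq, smul_eq_mul]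

/-- The difference of the two coefficient sequences solves the homogeneous system: the diagonal rows
kill it outside `F`, the nonsingular block kills it on `F`, and at 0 it vanishes by normalisation.
-/
theorem HasMomentForm.eq_of_moments {g : Torus → ℝ} (hg : IsControlProfile g) {α T : ℝ}
    (hα : 0 < α) (hT : 0 ≤ T) {q : ℤ → L2Time T} (hq : IsDualFamily α T q)
    {h h' : L2TimeSobolev s T} (hh : HasMomentForm q h) (hh' : HasMomentForm q h')
    (hm : ∀ k, momentCLM s hg.smooth α T k h = momentCLM s hg.smooth α T k h') : h = h' := by
  obtain ⟨F, M, h0, hinj, hF, hdiag⟩ := momentMatrix_structure hg hα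
  obtain ⟨c, hc0, hc⟩ := hh
  obtain ⟨c', hc0', hc'⟩ := hh'
  have hz (k : ℤ) : HasSum (fun j => (c j - c' j) * momentMatrix α g k j) 0 := by
    have h1 := (hasSum_moments hg.smooth hT hq hc k).sub (hasSum_moments hg.smooth hT hq hc' k)
    rw [hm, sub_self] at h1
    exact h1.congr_fun fun j => by ring
  have hd0 : c 0 - c' 0 = 0 := by rw [hc0, hc0', sub_zero]
  have hzero (k : ℤ) : c k - c' k = 0 := by
    by_cases hk0 : k = 0
    · rw [hk0, hd0]
    by_cases hkF : k ∈ F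
    · refine hinj (fun j => c j - c' j) (fun l hl => ?_) k hkF
      refine HasSum.unique (hasSum_sum_of_ne_finset_zero fun j hj => ?_) (hz l)
      by_cases hj0 : j = 0
      · rw [hj0, hd0, zero_mul]
      · rw [hF l hl j hj hj0, mul_zero]
    · obtain ⟨h1, -, h2⟩ := hdiag k hkF hk0
      have h3 := (hasSum_single k fun j hj => by rw [h2 j hj, mul_zero]).unique (hz k)
      exact (mul_eq_zero.1 h3).resolve_right h1
  have hcc : c = c' := funext fun k => sub_eq_zero.1 (hzero k)
  subst hcc
  exact hc.unique hc'

/-- A bounded solution operator of the moment problem. -/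
theorem exists_moment_solver (s : ℝ≥0) {g : Torus → ℝ} (hg : IsControlProfile g) {α T B : ℝ}
    (hα : 0 < α) (hT : 0 ≤ T) {q : ℤ → L2Time T} (hq : IsDualFamily α T q)
    (hB : ∀ j, ‖q j‖ ≤ B) :
    ∃ Ψ : Sobolev s →L[ℂ] L2TimeSobolev s T, ∀ d, HasMomentForm q (Ψ d) ∧
      ∀ k ≠ 0, momentCLM s hg.smooth α T k (Ψ d) = coeffCLM s k d := by
  classical
  obtain ⟨F, M, h0, hinj, hF, hdiag⟩ := momentMatrix_structure hg hα
  let L : (F → ℂ) →ₗ[ℂ] (F → ℂ) :=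
    (Matrix.of fun k j : F => momentMatrix α g k j).mulVecLin
  have hL (a : F → ℂ) (k : F) : L a k = ∑ j : F, a j * momentMatrix α g k j := by
    simp only [L, Matrix.mulVecLin_apply, Matrix.mulVec, dotProduct, Matrix.of_apply, mul_comm]
  -- An injective endomorphism of a finite-dimensional space is invertible, so the block over `F`
  -- has a bounded solution operator `R`.
  have hLinj : Function.Injective L := by
    refine (injective_iff_map_eq_zero L).2 fun a ha => ?_
    let a' : ℤ → ℂ := fun j => if hj : j ∈ F then a ⟨j, hj⟩ else 0
    have ha' (j : F) : a' j = a j := dif_pos j.2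
    have h1 := hinj a' fun k hk => by
      have h2 := congrFun ha ⟨k, hk⟩
      rw [hL, Pi.zero_apply] at h2
      rw [← Finset.sum_coe_sort]
      simpa only [ha'] using h2
    funext j
    rw [← ha', h1 j j.2, Pi.zero_apply]
  let e := LinearEquiv.ofInjectiveEndo L hLinj
  let R : Sobolev s →L[ℂ] (F → ℂ) := (LinearMap.toContinuousLinearMap e.symm.toLinearMap).comp
    (ContinuousLinearMap.pi fun k : F => coeffCLM s k)
  have hR (d : Sobolev s) (k : F) : ∑ j : F, R d j * momentMatrix α g k j = coeffCLM s k d := by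
    rw [← hL]
    have : L (R d) = fun k : F => coeffCLM s k d := e.apply_symm_apply _
    rw [this]
  -- Inverse diagonal entries away from the finite block. The zeros on `F` leave those modes to `R`,
  -- and the zero at index 0 enforces `h₀ = 0`.
  let b : ℤ → ℂ := fun j => if j ∈ F ∨ j = 0 then 0 else (momentMatrix α g j j)⁻¹
  have hb (j : ℤ) : ‖b j‖ ≤ max M 0 := by
    simp only [b]
    split_ifs with h
    · simp
    · rw [not_or] at h
      exact (hdiag j h.1 h.2).2.1.trans (le_max_left _ _)
  obtain ⟨Λ, hΛ⟩ := exists_synthesis s hB hb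
  let Ψ : Sobolev s →L[ℂ] L2TimeSobolev s T := Λ + ∑ j : F,
    ((ContinuousLinearMap.proj j).comp R).smulRight (tensorPsi s (q j) j)
  have hΨ (d : Sobolev s) : Ψ d = Λ d + ∑ j : F, R d j • tensorPsi s (q j) j := by
    simp only [Ψ, add_apply, sum_apply]
    rfl
  refine ⟨Ψ, fun d => ?_⟩
  let r : ℤ → ℂ := fun j => if hj : j ∈ F then R d ⟨j, hj⟩ else 0
  have hr (j : F) : r j = R d j := dif_pos j.2
  have hr' {j : ℤ} (hj : j ∉ F) : r j = 0 := dif_neg hj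
  let c : ℤ → ℂ := fun j => b j * fourierCoeff d j + r j
  have hc0 : c 0 = 0 := by simp [c, b, hr' h0]
  have hcF {j : ℤ} (hj : j ∈ F) : c j = r j := by simp [c, b, hj]
  have hc : HasSum (fun j => c j • tensorPsi s (q j) j) (Ψ d) := by
    rw [hΨ]
    have h1 : HasSum (fun j => r j • tensorPsi s (q j) j) (∑ j : F, R d j • tensorPsi s (q j) j) := by
      have h2 : HasSum (fun j => r j • tensorPsi s (q j) j) (∑ j ∈ F, r j • tensorPsi s (q j) j) :=
        hasSum_sum_of_ne_finset_zero fun j hj => by rw [hr' hj, zero_smul]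
      rw [← Finset.sum_coe_sort] at h2
      simpa only [hr] using h2
    exact ((hΛ d).add h1).congr_fun fun j => add_smul _ _ _
  refine ⟨⟨c, hc0, hc⟩, fun k hk0 => ?_⟩
  have hsum := hasSum_moments hg.smooth hT hq hc k
  by_cases hkF : k ∈ F
  · refine hsum.unique ?_
    have h2 : HasSum (fun j => c j * momentMatrix α g k j)
        (∑ j ∈ F, c j * momentMatrix α g k j) :=
      hasSum_sum_of_ne_finset_zero fun j hj => by
        by_cases hj0 : j = 0
        · rw [hj0, hc0, zero_mul]
        · rw [hF k hkF j hj hj0, mul_zero]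
    rw [Finset.sum_congr rfl fun j hj => by rw [hcF hj], ← Finset.sum_coe_sort] at h2
    simp only [hr] at h2
    rwa [hR d ⟨k, hkF⟩] at h2
  · obtain ⟨h1, -, h2⟩ := hdiag k hkF hk0
    have h3 := hsum.unique (hasSum_single k fun j hj => by rw [h2 j hj, mul_zero])
    have hck : c k = (momentMatrix α g k k)⁻¹ * fourierCoeff d k := by
      simp [c, b, hr' hkF, hkF, hk0]
    rw [h3, hck, mul_comm, mul_inv_cancel_left₀ h1, coeffCLM_apply]

theorem mean_eq_coeff (f : Sobolev s) : mean f = coeffCLM s 0 f := by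
  rw [coeffCLM_apply, fourierCoeff, AddCircle.integral_haarAddCircle, Complex.real_smul]
  simp [mean]

end

end Benjamin

/-! ### Assembly of the control operator -/

theorem mainTheorem5 (s : ℝ≥0) (α T : ℝ) (hα : 0 < α) (hT : 0 < T)
    (g : Torus → ℝ) (hg : IsControlProfile g) :
    ∃ q : ℤ → L2Time T, IsDualFamily α T q ∧ (∀ q', IsDualFamily α T q' → q' = q) ∧
    ∃ Φ : (Sobolev s × Sobolev s) →L[ℂ] L2TimeSobolev s T,
      (∀ u₀ u₁, HasMomentForm q (Φ (u₀, u₁))) ∧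
      (∀ u₀ u₁, mean u₀ = mean u₁ → Steers hg.smooth α T u₀ u₁ (Φ (u₀, u₁))) ∧
      (∀ u₀ u₁, mean u₀ = mean u₁ → ∀ h : L2TimeSobolev s T,
        HasMomentForm q h → Steers hg.smooth α T u₀ u₁ h → h = Φ (u₀, u₁)) ∧
      ∃ ν : ℝ, 0 < ν ∧ ∀ u₀ u₁, ‖Φ (u₀, u₁)‖ ≤ ν * (‖u₀‖ + ‖u₁‖) := by
  obtain ⟨q, B, hq, hB⟩ := exists_dualFamily hα hT
  obtain ⟨Ψ, hΨ⟩ := exists_moment_solver s hg hα hT.le hq hB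
  -- The data `U(-T)u₁ - u₀` of the moment problem.
  let D : (Sobolev s × Sobolev s) →L[ℂ] Sobolev s :=
    (evolution s α (-T)).toContinuousLinearMap.comp (ContinuousLinearMap.snd ℂ _ _)
      - ContinuousLinearMap.fst ℂ _ _
  have hsteer (u₀ u₁ : Sobolev s) (hu : mean u₀ = mean u₁) :
      Steers hg.smooth α T u₀ u₁ (Ψ (D (u₀, u₁))) := by
    rw [steers_iff hg.smooth α hT.le]
    intro k
    -- The moment at k = 0 is zero for every control of the given form, and the datum is `[u₁] -
    -- [u₀]` because `λ₀ = 0`. This is where equality of means enters.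
    by_cases hk : k = 0
    · subst hk
      obtain ⟨c, -, hc⟩ := (hΨ (D (u₀, u₁))).1
      have h1 := hasSum_moments hg.smooth hT.le hq hc 0
      simp only [momentMatrix_zero_left hg, mul_zero] at h1
      have h2 : coeffCLM s 0 (evolution s α (-T) u₁) = coeffCLM s 0 u₁ := by
        rw [coeffCLM_apply, coeff_evolution, symbol_eq_exp]
        simp [eigenvalue, coeffCLM_apply]
      rw [h1.unique hasSum_zero, map_sub, h2, ← mean_eq_coeff, ← mean_eq_coeff, hu, sub_self]
    · exact (hΨ (D (u₀, u₁))).2 k hk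
  -- Adding 1 to the operator norm only ensures `ν > 0`.
  refine ⟨q, hq, fun q' hq' => hq.unique hT.le hq', Ψ.comp D, fun u₀ u₁ => (hΨ _).1, hsteer,
    fun u₀ u₁ hu h hh hs => ?_, ‖Ψ.comp D‖ + 1, by positivity, fun u₀ u₁ => ?_⟩
  · refine hh.eq_of_moments hg hα hT.le hq (hΨ _).1 fun k => ?_
    rw [(steers_iff hg.smooth α hT.le u₀ u₁ h).1 hs k]
    exact ((steers_iff hg.smooth α hT.le u₀ u₁ _).1 (hsteer u₀ u₁ hu) k).symm
  · refine ((Ψ.comp D).le_opNorm _).trans ?_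
    have h1 : ‖((u₀, u₁) : Sobolev s × Sobolev s)‖ ≤ ‖u₀‖ + ‖u₁‖ :=
      max_le_add_of_nonneg (norm_nonneg _) (norm_nonneg _)
    have h2 := norm_nonneg (Ψ.comp D)
    gcongr
    linarith
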